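/- Let $\rho\in L^\infty(0,1)$ be real-valued with $\rho>0$ almost everywhere. A number $\lambda$ is a generalized eigenvalue of $$-u''=\lambda\rho u\ \text{ on }[0,1],\qquad u(0)=u(1)=0, \qquad (*)$$ if this problem has a nonzero solution $u\in C^1([0,1];\mathbb C)$ with $u'$ absolutely continuous (the equation holding almost everywhere); its multiplicity is the dimension of the space of solutions. Let $A=(-\Delta_D)^{-1}$ be the operator on the complex Hilbert space $L^2(0,1)$ for which $v=Af$ solves $-v''=f$, $v(0)=v(1)=0$, that is, $(Af)(x)=\int_0^1 g(x,y)f(y)\,dy$ with $g(x,y)=x(1-y)$ for $x\le y$ and $g(x,y)=y(1-x)$ for $y\le x$, and let $M_\rho f=\rho f$. Let $\mathbf M(\rho)=(\mathbf M_{ij}(\rho))_{i,j\ge1}$ be the infinite matrix $$\mathbf M_{ij}(\rho)=\frac1{\pi^2ij}\int_0^1\phi_i(x)\phi_j(x)\rho(x)\,dx,\qquad \phi_n(x)=\sqrt2\,\sin n\pi x.$$ If $\rho=\sum_{m=1}^{n}a_m\psi_m$ with real $a_m$ and real-valued $\psi_m\in L^\infty(0,1)$, put, for $\mathbf a=(a_1,\dots,a_n)$,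 $$\mathbf M_{ij}(\mathbf a)=\sum_{m=1}^{n}2a_m\,\frac{1}{\pi^2ij}\int_0^1\sin(i\pi x)\sin(j\pi x)\,\psi_m(x)\,dx.$$ A bounded operator $B$ on a Hilbert space is of trace class if $\sum_k\langle(B^*B)^{1/2}e_k,e_k\rangle<\infty$ for some orthonormal basis $(e_k)$; then $\mathrm{trace}(B)=\sum_k\langle Be_k,e_k\rangle$ for every orthonormal basis $(e_k)$. Then $(*)$ has infinitely many generalized eigenvalues, all of them are real and positive, and, counted with multiplicity, they can be listed as a nondecreasing sequence; all the series that define the entries of the matrix powers $\mathbf M(\rho)^s$, $s\ge1$, converge absolutely. Moreover, for every polynomial $\mathcal P\in\mathbb C[x]$ with $\mathcal P(0)=0$, the operator $\mathcal P(A\circ M_\rho)$ is of trace class, and for every enumeration $(\lambda_k)_{k\ge1}$ of the generalized eigenvalues, repeated according to multiplicity, $$\sum_{k=1}^\infty\mathcal P(\lambda_k^{-1})=\mathrm{trace}\big(\mathcal P(A\circ M_\rho)\big)=\mathrm{trace}\big(\mathcal P(\mathbf M(\rho))\big),$$ and, for every representation $\rho=\sum_m a_m\psi_m$ as above, this number is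 also equal to $\mathrm{trace}(\mathcal P(\mathbf M(\mathbf a)))$. Here the trace of an infinite matrix is the sum of its diagonal entries, and all the series converge absolutely. -/

import Mathlib

open MeasureTheory Set Filter Topology
open scoped ENNReal NNReal

noncomputable section

namespace StringDensity

/-- Lebesgue measure on the interval `(0,1)`. -/
abbrev unitMeasure : Measure ℝ := volume.restrict (Ioo (0 : ℝ) 1)

/-- The complex Hilbert space `L²(0,1)`. -/
abbrev L2 : Type := Lp ℂ 2 unitMeasure

/-- Real-valued densities in `L^∞(0,1)`. -/
abbrev Density : Type := Lp ℝ ∞ unitMeasure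

/-! ### The Dirichlet problem and the generalized eigenvalues -/

/-- `v` is the (strong) solution of `-v'' = h` on `[0,1]`, `v(0) = v(1) = 0`: `v` is continuously
differentiable on `[0,1]`, its derivative `w` is absolutely continuous and `-w' = h` almost
everywhere. -/
def IsDirichletSolution (h v : ℝ → ℂ) : Prop :=
  ∃ w : ℝ → ℂ,
    (∀ x ∈ Icc (0 : ℝ) 1, HasDerivWithinAt v (w x) (Icc 0 1) x) ∧
    AbsolutelyContinuousOnInterval w 0 1 ∧
    (∀ᵐ x ∂unitMeasure, HasDerivAt w (-h x) x) ∧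
    v 0 = 0 ∧ v 1 = 0

theorem IsDirichletSolution.add {h₁ h₂ v₁ v₂ : ℝ → ℂ} (H₁ : IsDirichletSolution h₁ v₁)
    (H₂ : IsDirichletSolution h₂ v₂) : IsDirichletSolution (h₁ + h₂) (v₁ + v₂) := by
  obtain ⟨w₁, a₁, b₁, c₁, d₁, e₁⟩ := H₁
  obtain ⟨w₂, a₂, b₂, c₂, d₂, e₂⟩ := H₂
  refine ⟨w₁ + w₂, fun x hx => (a₁ x hx).add (a₂ x hx), b₁.add b₂, ?_, by simp [d₁, d₂],
    by simp [e₁, e₂]⟩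
  filter_upwards [c₁, c₂] with x h1 h2
  convert! h1.add h2 using 1
  simp [add_comm]

theorem IsDirichletSolution.const_smul {h v : ℝ → ℂ} (c : ℂ) (H : IsDirichletSolution h v) :
    IsDirichletSolution (c • h) (c • v) := by
  obtain ⟨w, a, b, d, e, f⟩ := H
  refine ⟨c • w, fun x hx => (a x hx).const_smul c, b.const_smul c, ?_, by simp [e], by simp [f]⟩
  filter_upwards [d] with x h1
  convert! h1.const_smul c using 1
  simp

theorem IsDirichletSolution.zero : IsDirichletSolution 0 0 := by
  refine ⟨0, fun x _ => hasDerivWithinAt_const _ _ _, ?_, ?_, rfl, rfl⟩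
  · exact ((LipschitzWith.const (0 : ℂ)).lipschitzOnWith (s := uIcc 0 1)).absolutelyContinuousOnInterval
  · refine Eventually.of_forall fun x => ?_
    simp

/-- The solution space in `L²(0,1)` of `-u'' = μ ρ u`, `u(0) = u(1) = 0`. The number `μ` is a
generalized eigenvalue exactly when this space is nonzero, and its dimension is the multiplicity. -/
def eigenspace (ρ : Density) (μ : ℂ) : Submodule ℂ L2 where
  carrier := {u | ∃ v : ℝ → ℂ, (u : ℝ → ℂ) =ᵐ[unitMeasure] v ∧
    IsDirichletSolution (fun x => μ * (ρ x : ℂ) * v x) v}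
  zero_mem' := ⟨0, Lp.coeFn_zero _ _ _, by simpa using! IsDirichletSolution.zero⟩
  add_mem' := by
    rintro u₁ u₂ ⟨v₁, h₁, H₁⟩ ⟨v₂, h₂, H₂⟩
    refine ⟨v₁ + v₂, (Lp.coeFn_add u₁ u₂).trans (h₁.add h₂), ?_⟩
    convert! H₁.add H₂ using 1
    ext x
    simp [mul_add]
  smul_mem' := by
    rintro c u ⟨v, h, H⟩
    refine ⟨c • v, (Lp.coeFn_smul c u).trans (h.const_smul c), ?_⟩
    convert! H.const_smul c using 1
    ext x
    simp only [Pi.smul_apply, smul_eq_mul]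
    ring

/-- The sequence `lam` lists the generalized eigenvalues of `-u'' = λ ρ u`, `u(0) = u(1) = 0`,
each one as often as its multiplicity (and nothing else). -/
def IsEigenvalueEnumeration (ρ : Density) (lam : ℕ → ℂ) : Prop :=
  ∀ μ : ℂ, {k : ℕ | lam k = μ}.encard = Cardinal.toENat (Module.rank ℂ (eigenspace ρ μ))

/-! ### The operator `A ∘ M_ρ` -/

/-- The Green's function of `-d²/dx²` with Dirichlet conditions on `[0,1]`. -/
def green (x y : ℝ) : ℝ := if x ≤ y then x * (1 - y) else y * (1 - x)

theorem green_eq (x y : ℝ) : green x y = min x y - x * y := by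
  unfold green
  split_ifs with h
  · rw [min_eq_left h]; ring
  · rw [min_eq_right (le_of_not_ge h)]; ring

theorem continuous_green : Continuous fun p : ℝ × ℝ => green p.1 p.2 := by
  simp only [green_eq]; fun_prop

theorem abs_green_le {x y : ℝ} (hx : x ∈ Icc (0 : ℝ) 1) (hy : y ∈ Icc (0 : ℝ) 1) :
    |green x y| ≤ 1 := by
  obtain ⟨hx0, hx1⟩ := hx
  obtain ⟨hy0, hy1⟩ := hy
  unfold green
  split_ifs <;> rw [abs_le] <;> constructor <;> nlinarith

/-- `∫₀¹ g(x,y) f(y) dy`. -/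
def greenIntegral (f : ℝ → ℂ) (x : ℝ) : ℂ := ∫ y, (green x y : ℂ) * f y ∂unitMeasure

theorem integrable_L2 (f : L2) : Integrable f unitMeasure :=
  (Lp.memLp f).integrable (by norm_num)

theorem integrable_green_mul {f : ℝ → ℂ} (hf : Integrable f unitMeasure) {x : ℝ} :
    Integrable (fun y => (green x y : ℂ) * f y) unitMeasure := by
  have hc : Continuous fun y => green x y := continuous_green.comp (by fun_prop : Continuous fun y => (x, y))
  refine hf.bdd_mul (c := |x| + 1 + |x|) ?_ ?_
  · exact (Complex.continuous_ofReal.comp hc).aestronglyMeasurable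
  · filter_upwards [ae_restrict_mem measurableSet_Ioo] with y hy
    rw [Complex.norm_real, Real.norm_eq_abs, green_eq]
    have h1 : |min x y| ≤ |x| + 1 := by
      rcases min_choice x y with h | h <;> rw [h]
      · linarith
      · rw [abs_of_pos hy.1]; linarith [abs_nonneg x, hy.2]
    have h2 : |x * y| ≤ |x| := by
      rw [abs_mul, abs_of_pos hy.1]; nlinarith [abs_nonneg x, hy.2]
    linarith [abs_sub (min x y) (x * y)]

theorem norm_greenIntegral_le {f : ℝ → ℂ} (hf : Integrable f unitMeasure) {x : ℝ}
    (hx : x ∈ Icc (0 : ℝ) 1) : ‖greenIntegral f x‖ ≤ ∫ y, ‖f y‖ ∂unitMeasure := by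
  refine (norm_integral_le_integral_norm _).trans ?_
  refine integral_mono_ae (integrable_green_mul hf).norm hf.norm ?_
  filter_upwards [ae_restrict_mem measurableSet_Ioo] with y hy
  rw [norm_mul, Complex.norm_real, Real.norm_eq_abs]
  exact mul_le_of_le_one_left (norm_nonneg _) (abs_green_le hx ⟨hy.1.le, hy.2.le⟩)

theorem aestronglyMeasurable_greenIntegral {f : ℝ → ℂ} (hf : Integrable f unitMeasure) :
    AEStronglyMeasurable (greenIntegral f) unitMeasure := by
  refine AEStronglyMeasurable.integral_prod_right'
    (f := fun p : ℝ × ℝ => (green p.1 p.2 : ℂ) * f p.2) ?_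
  exact (Complex.continuous_ofReal.comp continuous_green).aestronglyMeasurable.mul
    hf.aestronglyMeasurable.comp_snd

theorem memLp_greenIntegral {f : ℝ → ℂ} (hf : Integrable f unitMeasure) :
    MemLp (greenIntegral f) 2 unitMeasure := by
  refine MemLp.of_bound (aestronglyMeasurable_greenIntegral hf) (∫ y, ‖f y‖ ∂unitMeasure) ?_
  filter_upwards [ae_restrict_mem measurableSet_Ioo] with x hx
  exact norm_greenIntegral_le hf ⟨hx.1.le, hx.2.le⟩

theorem integral_norm_le_norm (f : L2) : ∫ y, ‖f y‖ ∂unitMeasure ≤ ‖f‖ := by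
  have h : eLpNorm f 1 unitMeasure ≤ eLpNorm f 2 unitMeasure := by
    have : IsProbabilityMeasure unitMeasure := ⟨by simp⟩
    exact eLpNorm_le_eLpNorm_of_exponent_le (by norm_num) (Lp.aestronglyMeasurable f)
  rw [integral_norm_eq_lintegral_enorm (Lp.aestronglyMeasurable f), Lp.norm_def]
  refine ENNReal.toReal_mono (Lp.eLpNorm_ne_top f) ?_
  rwa [eLpNorm_one_eq_lintegral_enorm] at h

/-- The operator `A = (-Δ_D)⁻¹` on `L²(0,1)`, as the integral operator with kernel `g`; by
`isDirichletSolution_greenIntegral` the function `A f` solves `-v'' = f`, `v(0) = v(1) = 0`. -/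
def dirichletInverse : L2 →L[ℂ] L2 :=
  LinearMap.mkContinuous
    { toFun := fun f => (memLp_greenIntegral (integrable_L2 f)).toLp
      map_add' := fun f₁ f₂ => by
        rw [← MemLp.toLp_add]
        refine MemLp.toLp_congr _ _ (Eventually.of_forall fun x => ?_)
        simp only [greenIntegral, Pi.add_apply]
        rw [← integral_add (integrable_green_mul (integrable_L2 f₁))
          (integrable_green_mul (integrable_L2 f₂))]
        refine integral_congr_ae ?_
        filter_upwards [Lp.coeFn_add f₁ f₂] with y hy
        rw [hy, Pi.add_apply, mul_add]
      map_smul' := fun c f => by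
        rw [RingHom.id_apply, ← MemLp.toLp_const_smul]
        refine MemLp.toLp_congr _ _ (Eventually.of_forall fun x => ?_)
        simp only [greenIntegral, Pi.smul_apply, smul_eq_mul]
        rw [← integral_const_mul]
        refine integral_congr_ae ?_
        filter_upwards [Lp.coeFn_smul c f] with y hy
        rw [hy, Pi.smul_apply, smul_eq_mul]
        ring }
    1 (fun f => by
      rw [one_mul]
      refine Lp.norm_le_of_ae_bound (f := (memLp_greenIntegral (integrable_L2 f)).toLp)
        (norm_nonneg f) ?_ |>.trans ?_
      · filter_upwards [(memLp_greenIntegral (integrable_L2 f)).coeFn_toLp,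
          ae_restrict_mem measurableSet_Ioo] with x hx hx'
        rw [hx]
        exact (norm_greenIntegral_le (integrable_L2 f) ⟨hx'.1.le, hx'.2.le⟩).trans
          (integral_norm_le_norm f)
      · simp [measureUnivNNReal])

theorem coeFn_dirichletInverse (f : L2) :
    dirichletInverse f =ᵐ[unitMeasure] greenIntegral f :=
  (memLp_greenIntegral (integrable_L2 f)).coeFn_toLp

theorem absolutelyContinuousOnInterval_integral {f : ℝ → ℂ}
    (hf : IntervalIntegrable f volume 0 1) :
    AbsolutelyContinuousOnInterval (fun x => ∫ t in (0 : ℝ)..x, f t) 0 1 := by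
  have hc : ∀ c : ℂ, AbsolutelyContinuousOnInterval (fun _ : ℝ => c) 0 1 := fun c =>
    ((LipschitzWith.const c).lipschitzOnWith (s := uIcc 0 1)).absolutelyContinuousOnInterval
  have hre : IntervalIntegrable (fun t => (f t).re) volume 0 1 := ⟨hf.1.re, hf.2.re⟩
  have him : IntervalIntegrable (fun t => (f t).im) volume 0 1 := ⟨hf.1.im, hf.2.im⟩
  have h1 := (hre.absolutelyContinuousOnInterval_intervalIntegral (c := 0) (by simp)).smul (hc 1)
  have h2 := (him.absolutelyContinuousOnInterval_intervalIntegral (c := 0) (by simp)).smul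
    (hc Complex.I)
  have h3 := h1.add h2
  rw [absolutelyContinuousOnInterval_iff] at h3 ⊢
  have key : ∀ x ∈ Icc (0 : ℝ) 1, ∫ t in (0 : ℝ)..x, f t =
      (∫ t in (0 : ℝ)..x, (f t).re) • (1 : ℂ) + (∫ t in (0 : ℝ)..x, (f t).im) • Complex.I := by
    intro x hx
    have hfx : IntervalIntegrable f volume 0 x :=
      hf.mono_set (by rw [uIcc_of_le hx.1, uIcc_of_le zero_le_one]; exact Icc_subset_Icc_right hx.2)
    simp only [intervalIntegral.integral_of_le hx.1]
    have hi : Integrable f (volume.restrict (Ioc 0 x)) :=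
      (intervalIntegrable_iff_integrableOn_Ioc_of_le hx.1).1 hfx
    apply Complex.ext
    · simpa using (integral_re hi).symm
    · simpa using (integral_im hi).symm
  intro ε hε
  obtain ⟨δ, hδ, h⟩ := h3 ε hε
  refine ⟨δ, hδ, fun E hE hE' => ?_⟩
  refine lt_of_eq_of_lt (Finset.sum_congr rfl fun i hi => ?_) (h E hE hE')
  have hm := hE.1 i hi
  rw [uIcc_of_le zero_le_one] at hm
  rw [key _ hm.1, key _ hm.2]
  rfl

theorem hasDerivAt_greenIntegral {f : ℝ → ℂ} (hf : Integrable f unitMeasure) (x : ℝ) :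
    HasDerivAt (greenIntegral f)
      (∫ y, ((if x < y then 1 - y else -y : ℝ) : ℂ) * f y ∂unitMeasure) x := by
  refine (hasDerivAt_integral_of_dominated_loc_of_lip (bound := fun y => 2 * ‖f y‖)
    (F := fun x y => (green x y : ℂ) * f y) univ_mem
    (Eventually.of_forall fun x => (integrable_green_mul hf).aestronglyMeasurable)
    (integrable_green_mul hf) ?_ ?_ (hf.norm.const_mul 2) ?_).2
  · refine AEStronglyMeasurable.mul (Measurable.aestronglyMeasurable ?_) hf.aestronglyMeasurable
    refine Complex.measurable_ofReal.comp (Measurable.ite (measurableSet_lt (by fun_prop)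
      (by fun_prop)) (by fun_prop) (by fun_prop))
  · filter_upwards [ae_restrict_mem measurableSet_Ioo] with y hy
    refine LipschitzOnWith.of_dist_le_mul fun a _ b _ => ?_
    rw [dist_eq_norm, ← sub_mul, norm_mul, ← Complex.ofReal_sub, Complex.norm_real,
      Real.norm_eq_abs, Real.coe_nnabs, abs_of_nonneg (by positivity : (0 : ℝ) ≤ 2 * ‖f y‖),
      Real.dist_eq]
    have : |green a y - green b y| ≤ 2 * |a - b| := by
      have h1 : |min a y - min b y| ≤ |a - b| := by
        simpa using abs_min_sub_min_le_max a y b y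
      have h2 : |a * y - b * y| ≤ |a - b| := by
        rw [← sub_mul, abs_mul, abs_of_pos hy.1]; nlinarith [abs_nonneg (a - b), hy.2]
      rw [green_eq, green_eq, show min a y - a * y - (min b y - b * y) =
        (min a y - min b y) - (a * y - b * y) by ring]
      linarith [abs_sub (min a y - min b y) (a * y - b * y)]
    nlinarith [norm_nonneg (f y)]
  · have hne : ∀ᵐ y ∂unitMeasure, y ≠ x := Measure.ae_ne _ x
    filter_upwards [hne] with y hy
    refine HasDerivAt.mul_const ?_ _
    refine HasDerivAt.ofReal_comp (f := fun z => green z y) ?_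
    rcases lt_or_gt_of_ne hy with h | h
    · rw [if_neg (not_lt.2 h.le)]
      have : HasDerivAt (fun z : ℝ => y * (1 - z)) (-y) x := by
        simpa using! ((hasDerivAt_id x).const_sub 1).const_mul y
      refine this.congr_of_eventuallyEq ?_
      filter_upwards [lt_mem_nhds h] with z hz
      simp [green, not_le.2 hz]
    · rw [if_pos h]
      have : HasDerivAt (fun z : ℝ => z * (1 - y)) (1 - y) x := by
        simpa using! (hasDerivAt_id x).mul_const (1 - y)
      refine this.congr_of_eventuallyEq ?_
      filter_upwards [gt_mem_nhds h] with z hz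
      simp [green, hz.le]

/-- `A f` solves the Dirichlet problem with right-hand side `f`. -/
theorem isDirichletSolution_greenIntegral {f : ℝ → ℂ} (hf : Integrable f unitMeasure) :
    IsDirichletSolution f (greenIntegral f) := by
  have hi : IntervalIntegrable f volume 0 1 := by
    rw [intervalIntegrable_iff_integrableOn_Ioo_of_le zero_le_one]; exact hf
  set C : ℂ := ∫ y, ((1 - y : ℝ) : ℂ) * f y ∂unitMeasure
  have hC : Integrable (fun y : ℝ => ((1 - y : ℝ) : ℂ) * f y) unitMeasure := by
    refine hf.bdd_mul (c := 1) (by fun_prop) ?_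
    filter_upwards [ae_restrict_mem measurableSet_Ioo] with y hy
    rw [Complex.norm_real, Real.norm_eq_abs, abs_le]
    constructor <;> linarith [hy.1, hy.2]
  have key : ∀ x ∈ Icc (0 : ℝ) 1,
      (∫ y, ((if x < y then 1 - y else -y : ℝ) : ℂ) * f y ∂unitMeasure) =
        C - ∫ t in (0 : ℝ)..x, f t := by
    intro x hx
    have h1 : ∫ t in (0 : ℝ)..x, f t = ∫ y, (Iic x).indicator f y ∂unitMeasure := by
      rw [integral_indicator measurableSet_Iic, Measure.restrict_restrict measurableSet_Iic,
        intervalIntegral.integral_of_le hx.1]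
      rcases hx.2.lt_or_eq with h | h
      · congr 2
        ext y
        simp only [mem_Ioc, mem_inter_iff, mem_Iic, mem_Ioo]
        constructor
        · rintro ⟨h1, h2⟩; exact ⟨h2, h1, h2.trans_lt h⟩
        · rintro ⟨h1, h2, _⟩; exact ⟨h2, h1⟩
      · subst h
        rw [inter_eq_right.2 (show Ioo (0 : ℝ) 1 ⊆ Iic 1 from fun y hy => hy.2.le),
          integral_Ioc_eq_integral_Ioo]
    rw [h1, ← integral_sub hC (hf.indicator measurableSet_Iic)]
    refine integral_congr_ae (Eventually.of_forall fun y => ?_)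
    by_cases h : x < y
    · simp [h]
    · simp [h, not_lt.1 h]
      ring
  refine ⟨fun x => C - ∫ t in (0 : ℝ)..x, f t, fun x hx => ?_, ?_, ?_, ?_, ?_⟩
  · have := (hasDerivAt_greenIntegral hf x).hasDerivWithinAt (s := Icc 0 1)
    rwa [key x hx] at this
  · exact ((LipschitzWith.const C).lipschitzOnWith
      (s := uIcc 0 1)).absolutelyContinuousOnInterval.sub
        (absolutelyContinuousOnInterval_integral hi)
  · rw [ae_restrict_iff' measurableSet_Ioo]
    filter_upwards [hi.ae_hasDerivAt_integral] with x hx hx'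
    have := hx (by rw [uIcc_of_le zero_le_one]; exact ⟨hx'.1.le, hx'.2.le⟩) 0 (by simp)
    exact this.const_sub C
  · have : ∀ᵐ y ∂unitMeasure, (green 0 y : ℂ) * f y = 0 := by
      filter_upwards [ae_restrict_mem measurableSet_Ioo] with y hy
      simp [green, hy.1.le]
    simp [greenIntegral, integral_congr_ae this]
  · have : ∀ᵐ y ∂unitMeasure, (green 1 y : ℂ) * f y = 0 := by
      filter_upwards [ae_restrict_mem measurableSet_Ioo] with y hy
      simp [green, not_le.2 hy.2]
    simp [greenIntegral, integral_congr_ae this]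

/-- The multiplication operator `f ↦ ρ f` on `L²(0,1)`. -/
def mulOperator (ρ : Density) : L2 →L[ℂ] L2 :=
  (ContinuousLinearMap.mul ℂ ℂ).holderL unitMeasure ∞ 2 2 (Complex.ofRealCLM.compLp ρ)

/-- The operator `T = A ∘ M_ρ`. -/
def stringOperator (ρ : Density) : L2 →L[ℂ] L2 := dirichletInverse ∘L mulOperator ρ

/-! ### Trace class operators and traces -/

/-- `B` is of trace class: `∑ ⟨(B* B)^{1/2} e_k, e_k⟩` is finite for some orthonormal basis. -/
def IsTraceClass {H : Type} [NormedAddCommGroup H] [InnerProductSpace ℂ H] [CompleteSpace H]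
    (B : H →L[ℂ] H) : Prop :=
  ∃ (ι : Type) (e : HilbertBasis ι ℂ H), Summable fun k => inner ℂ (e k) (CFC.abs B (e k))

/-- `B` is of trace class and its trace, computed in any orthonormal basis, is `t`. -/
def HasTrace {H : Type} [NormedAddCommGroup H] [InnerProductSpace ℂ H] [CompleteSpace H]
    (B : H →L[ℂ] H) (t : ℂ) : Prop :=
  IsTraceClass B ∧
    ∀ (ι : Type) (e : HilbertBasis ι ℂ H), HasSum (fun k => inner ℂ (e k) (B (e k))) t

/-! ### Infinite matrices -/

/-- The product of two infinite matrices. -/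
def infMul (M N : Matrix ℕ ℕ ℂ) : Matrix ℕ ℕ ℂ := fun i j => ∑' k, M i k * N k j

/-- Powers of an infinite matrix. -/
def infPow (M : Matrix ℕ ℕ ℂ) : ℕ → Matrix ℕ ℕ ℂ
  | 0 => 1
  | s + 1 => infMul (infPow M s) M

/-- The infinite matrix `P(M)`. -/
def infAeval (P : Polynomial ℂ) (M : Matrix ℕ ℕ ℂ) : Matrix ℕ ℕ ℂ :=
  fun i j => P.sum fun s c => c * infPow M s i j

/-- The Dirichlet eigenfunctions `φ_n(x) = √2 sin(nπx)`. -/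
def dirichletEigenfunction (n : ℕ) (x : ℝ) : ℝ := √2 * Real.sin (n * Real.pi * x)

/-- The infinite matrix `M(ρ)`, with entries
`M_ij(ρ) = (π² i j)⁻¹ ∫₀¹ φ_i φ_j ρ dx`, `i, j ≥ 1`; rows and columns are indexed from `0` here. -/
def densityMatrix (ρ : Density) : Matrix ℕ ℕ ℂ := fun i j =>
  ((1 / (Real.pi ^ 2 * ((i : ℝ) + 1) * ((j : ℝ) + 1)) *
    ∫ x, dirichletEigenfunction (i + 1) x * dirichletEigenfunction (j + 1) x * ρ x ∂unitMeasure :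
      ℝ) : ℂ)

/-- The infinite matrix `M(a) = ∑ₘ 2 aₘ M(eₘ)` of the coefficient vector `a` with respect to the
functions `ψₘ`, where `M_ij(eₘ) = (π² i j)⁻¹ ∫₀¹ sin(iπx) sin(jπx) ψₘ(x) dx`. -/
def coeffMatrix {n : ℕ} (ψ : Fin n → Density) (a : Fin n → ℝ) : Matrix ℕ ℕ ℂ := fun i j =>
  ((∑ m, 2 * a m * (1 / (Real.pi ^ 2 * ((i : ℝ) + 1) * ((j : ℝ) + 1)) *
    ∫ x, Real.sin (((i : ℝ) + 1) * Real.pi * x) * Real.sin (((j : ℝ) + 1) * Real.pi * x) *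
      ψ m x ∂unitMeasure) : ℝ) : ℂ)

end StringDensity

end

/-! The operator `T = A ∘ M_ρ` is not self-adjoint, so it is compared with `S = R M_ρ R`, where `R`
is the positive square root of `A`. Since `T = R (R M_ρ)`, there is the intertwining `T R = R S`,
and `R` carries the kernel of `S - μ⁻¹` bijectively onto the solution space for `μ ≠ 0`
(`rank_eigenspace_eq`). As `ρ > 0`, the operator `S` is positive, compact and injective. It
therefore has an orthonormal eigenbasis with eigenvalues `κ i > 0`, and the generalized eigenvalues
are exactly the numbers `1 / κ i` with multiplicity.

The trace identity is an instance of `trace (CD) = trace (DC)` for Hilbert–Schmidt operators. On the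
sine basis `R` acts by `1/(πn)`, and `∑ 1/n²` converges, so `R` is Hilbert–Schmidt. Write `P = X Q`,
`C = R` and `D = R M_ρ Q(T)`. Then `CD = P(T)`, while `Q(T) R = R Q(S)` gives `DC = P(S)`. Thus
`P(T)` is of trace class, and its trace is that of `P(S)` in any basis
(`exists_trace_aeval_stringOperator`). The eigenbasis of `S` yields `∑ P(1/λ_k)`. The sine basis
yields the trace of `P(M(ρ))`, because `M(ρ)` is the matrix of `S`, not of `T`, in that basis
(`densityMatrix_eq_inner`).

Any two enumerations of the eigenvalues have the same finite fibers and so differ by a permutation,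
which does not affect an absolutely convergent sum. -/

noncomputable section

namespace StringDensity

/-! ### Hilbert–Schmidt operators -/

section HilbertSchmidt

set_option linter.unusedSectionVars false

variable {H : Type} [NormedAddCommGroup H] [InnerProductSpace ℂ H] [CompleteSpace H]

local notation "⟪" x ", " y "⟫" => inner ℂ x y

/-- Hilbert–Schmidt operators. -/
def IsHilbertSchmidt (C : H →L[ℂ] H) : Prop :=
  ∃ (ι : Type) (e : HilbertBasis ι ℂ H), Summable fun k => ‖C (e k)‖ ^ 2

theorem hasSum_norm_inner_sq {ι : Type} (e : HilbertBasis ι ℂ H) (x : H) :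
    HasSum (fun k => ‖⟪e k, x⟫‖ ^ 2) (‖x‖ ^ 2) := by
  have h := e.hasSum_inner_mul_inner x x
  have h2 := Complex.hasSum_re h
  simp only [inner_self_eq_norm_sq_to_K] at h2
  convert! h2 using 1
  · ext k
    rw [← inner_conj_symm x (e k), ← Complex.normSq_eq_conj_mul_self, Complex.normSq_eq_norm_sq]
    norm_cast
  · norm_cast

/-- Expanding `‖C* u_j‖²` by Parseval gives a double sum of `|⟨u_j, C e_k⟩|²`, and Bessel's
inequality bounds the sum over `j`. Only orthonormality of `u` is needed; incomplete families occur
in the trace-class criterion. -/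
theorem summable_norm_sq_of_adjoint {ι κ : Type} {C : H →L[ℂ] H} (e : HilbertBasis ι ℂ H)
    (h : Summable fun k => ‖C (e k)‖ ^ 2) {u : κ → H} (hu : Orthonormal ℂ u) :
    Summable fun j => ‖C.adjoint (u j)‖ ^ 2 := by
  refine summable_of_sum_le (c := ∑' k, ‖C (e k)‖ ^ 2) (fun _ => by positivity) fun s => ?_
  have h1 : ∀ j ∈ s, HasSum (fun k => ‖⟪u j, C (e k)⟫‖ ^ 2) (‖C.adjoint (u j)‖ ^ 2) := fun j _ => by
    convert! hasSum_norm_inner_sq e (C.adjoint (u j)) using 3 with k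
    rw [ContinuousLinearMap.adjoint_inner_right, norm_inner_symm]
  refine hasSum_le (fun k => ?_) (hasSum_sum h1) h.hasSum
  exact hu.sum_inner_products_le (C (e k))

namespace IsHilbertSchmidt

theorem adjoint {C : H →L[ℂ] H} (h : IsHilbertSchmidt C) : IsHilbertSchmidt C.adjoint := by
  obtain ⟨ι, e, he⟩ := h
  exact ⟨ι, e, summable_norm_sq_of_adjoint e he e.orthonormal⟩

/-- Passing to the adjoint twice replaces the one basis of the definition by an arbitrary
orthonormal family. -/
theorem summable {C : H →L[ℂ] H} (h : IsHilbertSchmidt C) {κ : Type} {u : κ → H}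
    (hu : Orthonormal ℂ u) : Summable fun j => ‖C (u j)‖ ^ 2 := by
  obtain ⟨ι, e, he⟩ := h.adjoint
  simpa using summable_norm_sq_of_adjoint e he hu

theorem comp_left {D : H →L[ℂ] H} (h : IsHilbertSchmidt D) (X : H →L[ℂ] H) :
    IsHilbertSchmidt (X ∘L D) := by
  obtain ⟨ι, e, he⟩ := h
  refine ⟨ι, e, (he.mul_left (‖X‖ ^ 2)).of_nonneg_of_le (fun _ => by positivity) fun k => ?_⟩
  rw [← mul_pow]
  exact pow_le_pow_left₀ (norm_nonneg _) (X.le_opNorm _) 2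

theorem comp_right {D : H →L[ℂ] H} (h : IsHilbertSchmidt D) (X : H →L[ℂ] H) :
    IsHilbertSchmidt (D ∘L X) := by
  have := (h.adjoint.comp_left X.adjoint).adjoint
  rwa [ContinuousLinearMap.adjoint_comp, ContinuousLinearMap.adjoint_adjoint,
    ContinuousLinearMap.adjoint_adjoint] at this

theorem summable_inner_sq {C : H →L[ℂ] H} (h : IsHilbertSchmidt C) {ι κ : Type}
    (e : HilbertBasis ι ℂ H) (f : HilbertBasis κ ℂ H) :
    Summable fun p : ι × κ => ‖⟪f p.2, C (e p.1)⟫‖ ^ 2 := by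
  refine (summable_prod_of_nonneg fun _ => sq_nonneg _).2
    ⟨fun k => (hasSum_norm_inner_sq f (C (e k))).summable, ?_⟩
  simpa only [fun k => (hasSum_norm_inner_sq f (C (e k))).tsum_eq] using h.summable e.orthonormal

theorem summable_inner_mul_inner {C D : H →L[ℂ] H} (hC : IsHilbertSchmidt C)
    (hD : IsHilbertSchmidt D) {ι κ : Type} (e : HilbertBasis ι ℂ H) (f : HilbertBasis κ ℂ H) :
    Summable fun p : ι × κ => ⟪e p.1, C (f p.2)⟫ * ⟪f p.2, D (e p.1)⟫ := by
  have h1 := (hC.summable_inner_sq f e).comp_injective Prod.swap_injective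
  refine Summable.of_norm_bounded (h1.add (hD.summable_inner_sq e f)) fun p => ?_
  rw [norm_mul]
  simp only [Function.comp_apply, Prod.fst_swap, Prod.snd_swap]
  nlinarith [sq_nonneg (‖⟪e p.1, C (f p.2)⟫‖ - ‖⟪f p.2, D (e p.1)⟫‖),
    sq_nonneg ‖⟪e p.1, C (f p.2)⟫‖, sq_nonneg ‖⟪f p.2, D (e p.1)⟫‖]

/-- Parseval in the second basis `f` turns the trace of `CD` in `e` into an absolutely convergent
double sum. That sum is symmetric under exchanging `(C, f)` with `(D, e)`, which is the source of
`trace (CD) = trace (DC)`. -/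
theorem hasSum_inner_comp {C D : H →L[ℂ] H} (hC : IsHilbertSchmidt C)
    (hD : IsHilbertSchmidt D) {ι κ : Type} (e : HilbertBasis ι ℂ H) (f : HilbertBasis κ ℂ H) :
    HasSum (fun k => ⟪e k, C (D (e k))⟫)
      (∑' p : ι × κ, ⟪e p.1, C (f p.2)⟫ * ⟪f p.2, D (e p.1)⟫) := by
  refine (hC.summable_inner_mul_inner hD e f).hasSum.prod_fiberwise fun k => ?_
  have := f.hasSum_inner_mul_inner (C.adjoint (e k)) (D (e k))
  simpa only [ContinuousLinearMap.adjoint_inner_left] using this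

theorem hasSum_inner_comp_swap {C D : H →L[ℂ] H} (hC : IsHilbertSchmidt C)
    (hD : IsHilbertSchmidt D) {ι κ : Type} (e : HilbertBasis ι ℂ H) (f : HilbertBasis κ ℂ H) :
    HasSum (fun i => ⟪f i, D (C (f i))⟫)
      (∑' p : ι × κ, ⟪e p.1, C (f p.2)⟫ * ⟪f p.2, D (e p.1)⟫) := by
  have h := hD.hasSum_inner_comp hC f e
  rw [← (Equiv.prodComm ι κ).tsum_eq] at h
  simpa only [Equiv.prodComm_apply, Prod.fst_swap, Prod.snd_swap, mul_comm] using h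

/-- A Hilbert–Schmidt operator is the norm limit of operators of finite rank. -/
theorem isCompactOperator {C : H →L[ℂ] H} (h : IsHilbertSchmidt C) : IsCompactOperator C := by
  obtain ⟨ι, e, he⟩ := h
  let G : ι → H →L[ℂ] H := fun k => (innerSL ℂ (e k)).smulRight (C (e k))
  have hG : ∀ k, IsCompactOperator (G k) := fun k => by
    have h1 : IsCompactOperator (ContinuousLinearMap.toSpanSingleton ℂ (C (e k))) :=
      isCompactOperator_of_locallyCompactSpace_rng _
    exact h1.comp_clm (innerSL ℂ (e k))
  have hF : ∀ s : Finset ι, IsCompactOperator (∑ k ∈ s, G k : H →L[ℂ] H) := fun s =>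
    Finset.sum_induction G (fun T : H →L[ℂ] H => IsCompactOperator T)
      (fun S T hS hT => hS.add hT) isCompactOperator_zero fun k _ => hG k
  have hS : Summable G := by
    rw [summable_iff_vanishing_norm]
    intro ε hε
    -- With tails of `∑ ‖C e_k‖²` below `ε²/4`, Cauchy–Schwarz and Bessel bound the operator norm of
    -- the corresponding rank-one sums by `ε/2`.
    obtain ⟨s, hs⟩ := summable_iff_vanishing_norm.1 he (ε ^ 2 / 4) (by positivity)
    refine ⟨s, fun t ht => lt_of_le_of_lt (ContinuousLinearMap.opNorm_le_bound _
      (half_pos hε).le fun x => ?_) (half_lt_self hε)⟩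
    have h1 := hs t ht
    rw [Real.norm_of_nonneg (Finset.sum_nonneg fun _ _ => sq_nonneg _)] at h1
    have h2 : ∑ k ∈ t, ‖⟪e k, x⟫‖ ^ 2 ≤ ‖x‖ ^ 2 := e.orthonormal.sum_inner_products_le x
    have h3 : ‖(∑ k ∈ t, G k) x‖ ≤ ∑ k ∈ t, ‖⟪e k, x⟫‖ * ‖C (e k)‖ := by
      rw [sum_apply]
      refine (norm_sum_le _ _).trans_eq (Finset.sum_congr rfl fun k _ => ?_)
      simp [G, norm_smul]
    refine abs_le_of_sq_le_sq' ?_ (by positivity) |>.2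
    calc ‖(∑ k ∈ t, G k) x‖ ^ 2 ≤ (∑ k ∈ t, ‖⟪e k, x⟫‖ * ‖C (e k)‖) ^ 2 := by gcongr
      _ ≤ (∑ k ∈ t, ‖⟪e k, x⟫‖ ^ 2) * ∑ k ∈ t, ‖C (e k)‖ ^ 2 :=
        Finset.sum_mul_sq_le_sq_mul_sq _ _ _
      _ ≤ ‖x‖ ^ 2 * (ε ^ 2 / 4) := by gcongr
      _ = (ε / 2 * ‖x‖) ^ 2 := by ring
  refine isCompactOperator_of_tendsto (l := atTop) (F := fun s => ∑ k ∈ s, G k) ?_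
    (Eventually.of_forall hF)
  have hC : ∑' k, G k = C := by
    ext x
    refine (hS.hasSum.mapL (ContinuousLinearMap.apply ℂ H x)).unique ?_
    convert! (e.hasSum_repr x).mapL C using 2 with k
    simp [G, e.repr_apply_apply]
  exact hC ▸ hS.hasSum

end IsHilbertSchmidt

end HilbertSchmidt

/-! ### Eigenbases, square roots and trace class -/

section Spectral

set_option linter.unusedSectionVars false

variable {H : Type} [NormedAddCommGroup H] [InnerProductSpace ℂ H] [CompleteSpace H]

local notation "⟪" x ", " y "⟫" => inner ℂ x y

theorem isSymmetric_of_isSelfAdjoint {T : H →L[ℂ] H} (h : IsSelfAdjoint T) :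
    (T : H →ₗ[ℂ] H).IsSymmetric := fun x y => h.isSymmetric x y

/-- A compact self-adjoint operator has an orthonormal basis of eigenvectors. -/
theorem exists_eigenbasis {T : H →L[ℂ] H} (hT : IsCompactOperator T) (hs : IsSelfAdjoint T) :
    ∃ (ι : Type) (e : HilbertBasis ι ℂ H) (κ : ι → ℂ), ∀ i, T (e i) = κ i • e i := by
  have hsym := isSymmetric_of_isSelfAdjoint hs
  have hV := hsym.orthogonalFamily_eigenspaces
  have hcl : ∀ μ : ℂ, CompleteSpace (Module.End.eigenspace (T : H →ₗ[ℂ] H) μ) := fun μ => by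
    refine IsClosed.completeSpace_coe (hs := ?_)
    have : (Module.End.eigenspace (T : H →ₗ[ℂ] H) μ : Set H) = {x | T x = μ • x} := by
      ext x; simp
    rw [this]
    exact isClosed_eq T.continuous (continuous_const_smul μ)
  choose w b hb using fun μ : ℂ =>
    exists_hilbertBasis ℂ (Module.End.eigenspace (T : H →ₗ[ℂ] H) μ)
  have ho : Orthonormal ℂ fun a : Σ μ : ℂ, w μ => ((b a.1 a.2 : _) : H) :=
    hV.orthonormal_sigma_orthonormal fun μ => (b μ).orthonormal
  refine ⟨Σ μ : ℂ, w μ, HilbertBasis.mkOfOrthogonalEqBot ho ?_, fun a => a.1, fun a => ?_⟩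
  -- A vector orthogonal to a basis of every eigenspace is orthogonal to all eigenspaces, so the
  -- spectral theorem forces it to vanish.
  · rw [eq_bot_iff, ← ContinuousLinearMap.orthogonalComplement_iSup_eigenspaces_eq_bot hT hsym]
    intro x hx
    rw [Submodule.mem_orthogonal] at hx ⊢
    intro u hu
    induction hu using Submodule.iSup_induction' with
    | mem μ u hu =>
      have h1 := (b μ).hasSum_repr ⟨u, hu⟩
      have h2 := ((h1.mapL (Submodule.subtypeL _)).mapL (innerSL ℂ x))
      have h3 : ∀ i, ⟪x, ((b μ i : _) : H)⟫ = 0 := fun i => by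
        rw [← inner_conj_symm, hx _ (Submodule.subset_span ⟨⟨μ, i⟩, rfl⟩), map_zero]
      have h4 : ⟪x, u⟫ = 0 := by
        refine h2.unique ?_
        convert! hasSum_zero with i
        simp [h3]
      rw [← inner_conj_symm, h4, map_zero]
    | zero => simp
    | add u v _ _ hu hv => rw [inner_add_left, hu, hv, add_zero]
  · rw [HilbertBasis.coe_mkOfOrthogonalEqBot]
    exact Module.End.mem_eigenspace_iff.1 (b a.1 a.2).2

theorem inner_eigenbasis_apply {ι : Type} {e : HilbertBasis ι ℂ H} {T : H →L[ℂ] H}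
    {κ : ι → ℝ} (hT : ∀ i, T (e i) = (κ i : ℂ) • e i) (i : ι) (x : H) :
    ⟪e i, T x⟫ = κ i * ⟪e i, x⟫ := by
  have h := ((e.hasSum_repr x).mapL T).mapL (innerSL ℂ (e i))
  refine h.unique ?_
  have h2 := hasSum_single (f := fun j => innerSL ℂ (e i) (T (e.repr x j • e j))) i fun j hj => by
    simp [hT, e.orthonormal.2 (Ne.symm hj)]
  convert! h2 using 1
  simp [hT, e.repr_apply_apply, e.orthonormal.1 i, mul_comm]

theorem isPositive_of_eigenbasis {ι : Type} {e : HilbertBasis ι ℂ H} {T : H →L[ℂ] H}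
    {κ : ι → ℝ} (hT : ∀ i, T (e i) = (κ i : ℂ) • e i) (hκ : ∀ i, 0 ≤ κ i) : T.IsPositive := by
  rw [ContinuousLinearMap.isPositive_iff_complex]
  intro x
  have h : HasSum (fun i => ((κ i * ‖⟪e i, x⟫‖ ^ 2 : ℝ) : ℂ)) ⟪T x, x⟫ := by
    convert! e.hasSum_inner_mul_inner (T x) x using 2 with i
    rw [← inner_conj_symm (T x), inner_eigenbasis_apply hT, map_mul, mul_assoc,
      ← Complex.normSq_eq_norm_sq, Complex.conj_ofReal, Complex.ofReal_mul,
      Complex.normSq_eq_conj_mul_self]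
  have hre : HasSum (fun i => κ i * ‖⟪e i, x⟫‖ ^ 2) (⟪T x, x⟫).re := by
    simpa only [Complex.ofReal_re] using Complex.hasSum_re h
  have him : (⟪T x, x⟫).im = 0 := by
    refine (Complex.hasSum_im h).unique ?_
    simpa only [Complex.ofReal_im] using hasSum_zero
  exact ⟨Complex.ext rfl him.symm, hre.nonneg fun i => mul_nonneg (hκ i) (sq_nonneg _)⟩

theorem exists_isPositive_mul_self_eq {A : H →L[ℂ] H} (hA : A.IsPositive) :
    ∃ R : H →L[ℂ] H, R.IsPositive ∧ R * R = A :=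
  ⟨CFC.sqrt A, (ContinuousLinearMap.nonneg_iff_isPositive _).1 (CFC.sqrt_nonneg A),
    CFC.sqrt_mul_sqrt_self A ((ContinuousLinearMap.nonneg_iff_isPositive _).2 hA)⟩

/-- The positive square root acts on an eigenvector by the square root of the eigenvalue. -/
theorem apply_eigenvector_of_sq {S X : H →L[ℂ] H} (hS : S.IsPositive) (hX : S * S = X)
    {x : H} {s : ℝ} (hs : 0 ≤ s) (hx : X x = ((s ^ 2 : ℝ) : ℂ) • x) : S x = (s : ℂ) • x := by
  have hSS : S (S x) = ((s ^ 2 : ℝ) : ℂ) • x := by rw [← hx, ← hX]; rfl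
  -- Put `y = S x - s x`. Then `(S + s) y = S² x - s² x = 0`, so `⟨y, S y⟩ + s ‖y‖² = 0`; both terms
  -- are nonnegative, hence `s ‖y‖² = 0`. The case `s = 0` is settled by `‖S x‖² = ⟨x, S² x⟩ = 0`.
  have key : ⟪S x - (s : ℂ) • x, S (S x - (s : ℂ) • x) + (s : ℂ) • (S x - (s : ℂ) • x)⟫ = 0 := by
    have : S (S x - (s : ℂ) • x) + (s : ℂ) • (S x - (s : ℂ) • x) = 0 := by
      rw [map_sub, map_smul, hSS, smul_sub, smul_smul]
      push_cast
      rw [pow_two]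
      abel
    rw [this, inner_zero_right]
  rw [inner_add_right, inner_smul_right, inner_self_eq_norm_sq_to_K] at key
  have hp := hS.re_inner_nonneg_right (S x - (s : ℂ) • x)
  have this : s * ‖S x - (s : ℂ) • x‖ ^ 2 = 0 := by
    have h1 : RCLike.re ((s : ℂ) * (RCLike.ofReal ‖S x - (s : ℂ) • x‖ : ℂ) ^ 2) =
        s * ‖S x - (s : ℂ) • x‖ ^ 2 := by
      simp [← Complex.ofReal_pow]
    have hre := congrArg (RCLike.re : ℂ → ℝ) key
    rw [map_add, h1, map_zero] at hre
    linarith [mul_nonneg hs (sq_nonneg ‖S x - (s : ℂ) • x‖)]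
  rcases mul_eq_zero.1 this with h | h
  · subst h
    have h0 : ⟪S x, S x⟫ = 0 := by
      rw [hS.inner_left_eq_inner_right, hSS]; simp
    simpa using h0
  · rw [sq_eq_zero_iff, norm_eq_zero, sub_eq_zero] at h
    exact h

/-- A product of two Hilbert–Schmidt operators is of trace class. -/
theorem IsHilbertSchmidt.isTraceClass_comp {C D : H →L[ℂ] H} (hC : IsHilbertSchmidt C)
    (hD : IsHilbertSchmidt D) : IsTraceClass (C ∘L D) := by
  set B := C ∘L D with hB
  have hcomp : IsCompactOperator (star B * B) :=
    (hC.comp_right D).isCompactOperator.clm_comp (star B)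
  obtain ⟨ι, e, κ, he⟩ := exists_eigenbasis hcomp (IsSelfAdjoint.star_mul_self B)
  have hinner : ∀ i j, ⟪B (e i), B (e j)⟫ = κ j * ⟪e i, e j⟫ := fun i j => by
    rw [← inner_smul_right, ← he j]
    simp [ContinuousLinearMap.star_eq_adjoint, ContinuousLinearMap.adjoint_inner_right]
  have hκ : ∀ i, κ i = ((‖B (e i)‖ ^ 2 : ℝ) : ℂ) := fun i => by
    have := hinner i i
    rw [inner_self_eq_norm_sq_to_K, inner_self_eq_norm_sq_to_K, e.orthonormal.1 i] at this
    simpa using this.symm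
  have habs : ∀ i, CFC.abs B (e i) = (‖B (e i)‖ : ℂ) • e i := fun i =>
    apply_eigenvector_of_sq ((ContinuousLinearMap.nonneg_iff_isPositive _).1 (CFC.abs_nonneg B))
      (CFC.abs_mul_abs B) (norm_nonneg _) (by rw [he i, hκ i])
  refine ⟨ι, e, ?_⟩
  have hsum : Summable fun i => ‖B (e i)‖ := by
    -- On this set the normalized images `u i` of `e i` are orthonormal, because `B* B` is diagonal
    -- in `e`. Then `‖B e_i‖ = ⟨C* u_i, D e_i⟩` is dominated by `‖C* u_i‖² + ‖D e_i‖²`, which is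
    -- summable.
    let s : Set ι := {i | B (e i) ≠ 0}
    have hs0 : ∀ i ∉ s, ‖B (e i)‖ = 0 := fun i hi => by simpa [s] using hi
    suffices h : Summable ((fun i => ‖B (e i)‖) ∘ ((↑) : s → ι)) from
      ((hasSum_subtype_iff_of_support_subset fun i hi => by simpa [s] using hi).1 h.hasSum).summable
    let u : s → H := fun i => (‖B (e i)‖ : ℂ)⁻¹ • B (e i)
    have hne : ∀ i : s, (‖B (e i)‖ : ℂ) ≠ 0 := fun i => by
      simpa using (show B (e i) ≠ 0 from i.2)
    have hu : Orthonormal ℂ u := by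
      refine ⟨fun i => ?_, fun i j hij => ?_⟩
      · simp only [u, norm_smul, norm_inv, Complex.norm_real, norm_norm]
        exact inv_mul_cancel₀ (by simpa using hne i)
      · simp [u, inner_smul_left, inner_smul_right, hinner,
          e.orthonormal.2 (fun h => hij (Subtype.ext h))]
    have h1 : Summable fun i : s => ‖C.adjoint (u i)‖ ^ 2 := hC.adjoint.summable hu
    have h2 : Summable fun i : s => ‖D (e i)‖ ^ 2 :=
      (hD.summable e.orthonormal).subtype s
    refine (h1.add h2).of_nonneg_of_le (fun _ => norm_nonneg _) fun i => ?_
    have h3 : ⟪C.adjoint (u i), D (e i)⟫ = (‖B (e i)‖ : ℂ) := by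
      rw [ContinuousLinearMap.adjoint_inner_left]
      change ⟪u i, B (e i)⟫ = _
      simp only [u, inner_smul_left, inner_self_eq_norm_sq_to_K, map_inv₀, Complex.conj_ofReal]
      have := hne i
      change _ * ((‖B (e i)‖ : ℂ) ^ 2) = _
      field_simp
    have h4 := norm_inner_le_norm (𝕜 := ℂ) (C.adjoint (u i)) (D (e i))
    rw [h3, Complex.norm_real, norm_norm] at h4
    simp only [Function.comp_apply]
    nlinarith [sq_nonneg (‖C.adjoint (u i)‖ - ‖D (e i)‖), sq_nonneg ‖C.adjoint (u i)‖,
      sq_nonneg ‖D (e i)‖]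
  refine (Complex.hasSum_ofReal.2 hsum.hasSum).summable.congr fun i => ?_
  rw [habs, inner_smul_right, inner_self_eq_norm_sq_to_K, e.orthonormal.1 i]
  simp

/-- The traces of `CD` and `DC` agree. -/
theorem IsHilbertSchmidt.exists_hasTrace_comp {C D : H →L[ℂ] H} (hC : IsHilbertSchmidt C)
    (hD : IsHilbertSchmidt D) : ∃ t : ℂ, HasTrace (C ∘L D) t ∧
      ∀ (ι : Type) (f : HilbertBasis ι ℂ H), HasSum (fun i => ⟪f i, D (C (f i))⟫) t := by
  obtain ⟨ι₀, e₀, -⟩ := id hC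
  set t := ∑' p : ι₀ × ι₀, ⟪e₀ p.1, C (e₀ p.2)⟫ * ⟪e₀ p.2, D (e₀ p.1)⟫
  -- The double sum over a pair of bases equals the trace of `CD` in the first and of `DC` in the
  -- second. Varying one basis at a time shows that it depends on neither.
  have h1 : ∀ (ι : Type) (f : HilbertBasis ι ℂ H), HasSum (fun i => ⟪f i, D (C (f i))⟫) t :=
    fun ι f => by
      have h := hC.hasSum_inner_comp_swap hD e₀ f
      rwa [(hC.hasSum_inner_comp hD e₀ f).unique (hC.hasSum_inner_comp hD e₀ e₀)] at h
  refine ⟨t, ⟨hC.isTraceClass_comp hD, fun ι e => ?_⟩, h1⟩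
  have h := hC.hasSum_inner_comp hD e e₀
  rwa [(hC.hasSum_inner_comp_swap hD e e₀).unique (h1 ι₀ e₀)] at h

/-- If `T` is diagonal in an orthonormal basis, the dimension of an eigenspace is the number of
basis vectors in it. -/
theorem toENat_rank_eigenspace {ι : Type} {e : HilbertBasis ι ℂ H} {T : H →L[ℂ] H}
    {κ : ι → ℝ} (hT : ∀ i, T (e i) = (κ i : ℂ) • e i) (c : ℂ) (hf : {i | (κ i : ℂ) = c}.Finite) :
    Cardinal.toENat (Module.rank ℂ (Module.End.eigenspace (T : H →ₗ[ℂ] H) c)) =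
      {i | (κ i : ℂ) = c}.encard := by
  set s := {i | (κ i : ℂ) = c}
  have hspan : Module.End.eigenspace (T : H →ₗ[ℂ] H) c = Submodule.span ℂ (range fun i : s => e i) := by
    refine le_antisymm (fun x hx => ?_) (Submodule.span_le.2 ?_)
    · have hx' : T x = c • x := Module.End.mem_eigenspace_iff.1 hx
      have h0 : ∀ i ∉ s, ⟪e i, x⟫ = 0 := fun i hi => by
        have h := inner_eigenbasis_apply hT i x
        rw [hx', inner_smul_right] at h
        have h2 : ((κ i : ℂ) - c) * ⟪e i, x⟫ = 0 := by rw [sub_mul, h, sub_self]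
        exact (mul_eq_zero.1 h2).resolve_left (sub_ne_zero.2 hi)
      -- Finiteness of the fiber makes the expansion a finite sum, so the eigenspace is the
      -- algebraic span, with no closure, and its rank counts basis vectors.
      have hsum : x = ∑ i ∈ hf.toFinset, e.repr x i • e i :=
        (e.hasSum_repr x).unique (hasSum_sum_of_ne_finset_zero fun i hi => by
          rw [e.repr_apply_apply, h0 i (by simpa using hi), zero_smul])
      rw [hsum]
      refine Submodule.sum_mem _ fun i hi => Submodule.smul_mem _ _ (Submodule.subset_span ?_)
      exact ⟨⟨i, by simpa using hi⟩, rfl⟩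
    · rintro _ ⟨i, rfl⟩
      refine Module.End.mem_eigenspace_iff.2 ?_
      rw [← i.2]
      exact hT i
  have hli : LinearIndependent ℂ fun i : s => e i :=
    e.orthonormal.linearIndependent.comp _ Subtype.val_injective
  rw [hspan, rank_span hli, Cardinal.mk_range_eq _ hli.injective]
  rfl

end Spectral

/-! ### Sorting and rearranging families -/

section Enumeration

/-- An infinite linear order whose initial segments are finite is isomorphic to `ℕ`. -/
theorem nonempty_orderIso_nat {α : Type*} [LinearOrder α] [Infinite α]
    (h : ∀ a : α, (Iic a).Finite) : Nonempty (ℕ ≃o α) := by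
  let : LocallyFiniteOrder α :=
    LocallyFiniteOrder.ofFiniteIcc fun a b => (h b).subset Icc_subset_Iic_self
  obtain ⟨a₀⟩ := Infinite.nonempty α
  obtain ⟨m, hm, hmin⟩ := Set.exists_min_image (Iic a₀) id (h a₀) ⟨a₀, le_refl a₀⟩
  let : OrderBot α :=
    { bot := m
      bot_le := fun b => (le_total a₀ b).elim (fun hb => le_trans hm hb) fun hb => hmin b hb }
  have : NoMaxOrder α := ⟨fun a => by
    by_contra! hc
    exact Set.infinite_univ ((h a).subset fun b _ => hc b)⟩
  let : SuccOrder α := LinearLocallyFiniteOrder.succOrder α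
  let : PredOrder α := LinearLocallyFiniteOrder.predOrder α
  exact ⟨orderIsoNatOfLinearSuccPredArch.symm⟩

/-- An infinite family of reals with finite sublevel sets can be sorted. -/
theorem exists_equiv_monotone {ι : Type*} [Infinite ι] (lam : ι → ℝ)
    (h : ∀ c, {i | lam i ≤ c}.Finite) : ∃ σ : ℕ ≃ ι, Monotone (lam ∘ σ) := by
  classical
  let : LinearOrder ι := linearOrderOfSTO WellOrderingRel
  -- Ties between equal values are broken by an arbitrary linear order on the index set, which makes
  -- the sorting key injective.
  let g : ι → ℝ ×ₗ ι := fun i => toLex (lam i, i)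
  have hg : Function.Injective g := fun i j hij => congrArg (fun p => (ofLex p).2) hij
  have hmono : ∀ i j, g i ≤ g j → lam i ≤ lam j := fun i j hij =>
    (Prod.Lex.le_iff.1 hij).elim le_of_lt fun h => h.1.le
  let E := Equiv.ofInjective g hg
  have hE : ∀ c : range g, g (E.symm c) = c := fun c => Equiv.apply_ofInjective_symm hg c
  have : Infinite (range g) := Infinite.of_injective E E.injective
  obtain ⟨σ⟩ := nonempty_orderIso_nat (α := range g) fun a => by
    refine ((h (lam (E.symm a))).image E).subset fun b hb => ⟨E.symm b, hmono _ _ ?_, by simp⟩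
    rw [hE, hE]
    exact hb
  refine ⟨σ.toEquiv.trans E.symm, fun m n hmn => hmono _ _ ?_⟩
  simp only [Equiv.trans_apply, hE]
  exact σ.monotone hmn

/-- Two families whose fibers are finite and of the same size are rearrangements of each other. -/
theorem exists_equiv_of_encard_fiber_eq {α β γ : Type*} (f : α → γ) (g : β → γ)
    (hfin : ∀ c, {b | g b = c}.Finite) (h : ∀ c, {a | f a = c}.encard = {b | g b = c}.encard) :
    ∃ σ : α ≃ β, ∀ a, g (σ a) = f a := by
  have hfib : ∀ c, Nonempty ({a // f a = c} ≃ {b // g b = c}) := fun c => by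
    have hg : Finite {b // g b = c} := hfin c
    have hf : Finite {a // f a = c} := by
      refine (Set.encard_lt_top_iff (s := {a | f a = c})).1 ?_
      rw [h c]
      exact Set.encard_lt_top_iff.2 (hfin c)
    refine Finite.card_eq.1 ?_
    have := congrArg ENat.toNat (h c)
    exact this
  let e := fun c => (hfib c).some
  refine ⟨(Equiv.sigmaFiberEquiv f).symm.trans ((Equiv.sigmaCongrRight e).trans
    (Equiv.sigmaFiberEquiv g)), fun a => ?_⟩
  exact (e (f a) ⟨a, rfl⟩).2

end Enumeration

/-! ### Uniqueness for the Dirichlet problem, and eigenfunctions of `T` -/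

section Dirichlet

theorem IsDirichletSolution.congr_ae {h h' v : ℝ → ℂ} (H : IsDirichletSolution h v)
    (hh : h =ᵐ[unitMeasure] h') : IsDirichletSolution h' v := by
  obtain ⟨w, a, b, c, d⟩ := H
  refine ⟨w, a, b, ?_, d⟩
  filter_upwards [c, hh] with x hx hx'
  rwa [← hx']

theorem IsDirichletSolution.continuousOn {h v : ℝ → ℂ} (H : IsDirichletSolution h v) :
    ContinuousOn v (Icc 0 1) := by
  obtain ⟨w, a, -⟩ := H
  exact fun x hx => (a x hx).continuousWithinAt

/-- An absolutely continuous function with derivative zero almost everywhere is constant, so `v` is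
affine, and the boundary values kill it. -/
theorem IsDirichletSolution.eq_zero {v : ℝ → ℂ} (H : IsDirichletSolution 0 v) :
    ∀ x ∈ Icc (0 : ℝ) 1, v x = 0 := by
  have hcont := H.continuousOn
  obtain ⟨w, a, b, c, h0, h1⟩ := H
  obtain ⟨C, hC⟩ := b.const_of_ae_hasDerivAt_zero (by
    rw [ae_restrict_iff' measurableSet_Ioo] at c
    filter_upwards [c, Measure.ae_ne volume 0, Measure.ae_ne volume 1] with x hx hx0 hx1 hx'
    rw [uIcc_of_le zero_le_one] at hx'
    simpa using hx ⟨lt_of_le_of_ne hx'.1 (Ne.symm hx0), lt_of_le_of_ne hx'.2 hx1⟩)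
  rw [uIcc_of_le zero_le_one] at hC
  have key := constant_of_has_deriv_right_zero (f := fun x : ℝ => v x - x * C) (a := 0) (b := 1)
    (hcont.sub (by fun_prop)) (fun x hx => by
      have hx' : x ∈ Icc (0 : ℝ) 1 := ⟨hx.1, hx.2.le⟩
      have h2 : HasDerivWithinAt (fun x : ℝ => (x : ℂ) * C) C (Icc 0 1) x := by
        simpa using! ((hasDerivAt_id x).ofReal_comp.mul_const C).hasDerivWithinAt
      have h3 := (a x hx').sub h2
      rw [hC x hx', sub_self] at h3
      exact h3.mono_of_mem_nhdsWithin
        (mem_of_superset (Icc_mem_nhdsGE hx.2) (Icc_subset_Icc_left hx.1)))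
  have hC0 : C = 0 := by
    have := key 1 ⟨zero_le_one, le_rfl⟩
    simpa [h0, h1] using this
  intro x hx
  simpa [hC0, h0] using key x hx

/-- Uniqueness for the Dirichlet problem. -/
theorem IsDirichletSolution.eq_greenIntegral {h v : ℝ → ℂ} (H : IsDirichletSolution h v)
    (hh : Integrable h unitMeasure) : ∀ x ∈ Icc (0 : ℝ) 1, v x = greenIntegral h x := by
  intro x hx
  have h1 := H.add ((isDirichletSolution_greenIntegral hh).const_smul (-1))
  have h2 := IsDirichletSolution.eq_zero (v := v + (-1 : ℂ) • greenIntegral h)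
    (by convert! h1 using 1; simp) x hx
  simpa [← sub_eq_add_neg, sub_eq_zero] using h2

theorem greenIntegral_congr_ae {f g : ℝ → ℂ} (h : f =ᵐ[unitMeasure] g) :
    greenIntegral f = greenIntegral g := by
  ext x
  exact integral_congr_ae (h.mono fun y hy => by simp only [hy])

theorem greenIntegral_const_smul (c : ℂ) (f : ℝ → ℂ) :
    greenIntegral (fun x => c * f x) = fun x => c * greenIntegral f x := by
  ext x
  rw [greenIntegral, greenIntegral, ← integral_const_mul]
  simp only [mul_left_comm]

theorem coeFn_mulOperator (ρ : Density) (u : L2) :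
    mulOperator ρ u =ᵐ[unitMeasure] fun x => (ρ x : ℂ) * u x := by
  have h := (ContinuousLinearMap.mul ℂ ℂ).coeFn_holder (r := 2) (Complex.ofRealCLM.compLp ρ) u
  filter_upwards [h, Complex.ofRealCLM.coeFn_compLp ρ] with x hx hx'
  simpa [hx'] using! hx

theorem coeFn_stringOperator (ρ : Density) (u : L2) :
    stringOperator ρ u =ᵐ[unitMeasure] greenIntegral fun x => (ρ x : ℂ) * u x := by
  rw [← greenIntegral_congr_ae (coeFn_mulOperator ρ u)]
  exact coeFn_dirichletInverse _

theorem integrable_density_mul (ρ : Density) (u : L2) :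
    Integrable (fun x => (ρ x : ℂ) * u x) unitMeasure :=
  (integrable_L2 (mulOperator ρ u)).congr (coeFn_mulOperator ρ u)

/-- By uniqueness, solving the equation means `v = μ A(ρ v)`. Conversely, the Green integral
provides the `C¹` representative of the class `u`. -/
theorem mem_eigenspace_iff (ρ : Density) {μ : ℂ} (hμ : μ ≠ 0) (u : L2) :
    u ∈ eigenspace ρ μ ↔ stringOperator ρ u = μ⁻¹ • u := by
  constructor
  · rintro ⟨v, hv, H⟩
    have hae : (fun x => μ * (ρ x : ℂ) * v x) =ᵐ[unitMeasure] fun x => μ * ((ρ x : ℂ) * u x) :=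
      hv.mono fun x hx => by simp only [hx, mul_assoc]
    have H' := (H.congr_ae hae).eq_greenIntegral ((integrable_density_mul ρ u).const_mul μ)
    rw [greenIntegral_const_smul] at H'
    refine Lp.ext ?_
    filter_upwards [coeFn_stringOperator ρ u, Lp.coeFn_smul μ⁻¹ u, hv,
      ae_restrict_mem measurableSet_Ioo] with x h1 h2 h3 h4
    rw [h1, h2, Pi.smul_apply, h3, H' x ⟨h4.1.le, h4.2.le⟩, smul_eq_mul, inv_mul_cancel_left₀ hμ]
  · intro hu
    have hi := (integrable_density_mul ρ u).const_mul μ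
    have hv : (u : ℝ → ℂ) =ᵐ[unitMeasure] greenIntegral fun x => μ * ((ρ x : ℂ) * u x) := by
      rw [greenIntegral_const_smul]
      filter_upwards [coeFn_stringOperator ρ u, Lp.coeFn_smul μ⁻¹ u] with x h1 h2
      rw [← h1, hu, h2, Pi.smul_apply, smul_eq_mul, mul_inv_cancel_left₀ hμ]
    exact ⟨_, hv, (isDirichletSolution_greenIntegral hi).congr_ae
      (hv.mono fun x hx => by simp only [← hx, mul_assoc])⟩

/-- An enumeration is tested at every complex `μ`, including `0`, where the correspondence with
`μ⁻¹` breaks down. -/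
theorem eigenspace_zero (ρ : Density) : eigenspace ρ 0 = ⊥ := by
  rw [eq_bot_iff]
  rintro u ⟨v, hv, H⟩
  have H' := IsDirichletSolution.eq_zero (v := v) (by convert! H using 1; ext; simp)
  rw [Submodule.mem_bot]
  refine Lp.ext ?_
  filter_upwards [hv, Lp.coeFn_zero ℂ 2 unitMeasure, ae_restrict_mem measurableSet_Ioo]
    with x h1 h2 h3
  rw [h1, h2, H' x ⟨h3.1.le, h3.2.le⟩, Pi.zero_apply]

end Dirichlet

/-! ### The sine basis diagonalizes `A` -/

section SineBasis

theorem integral_unitMeasure {E : Type*} [NormedAddCommGroup E] [NormedSpace ℝ E] (f : ℝ → E) :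
    ∫ x, f x ∂unitMeasure = ∫ x in (0 : ℝ)..1, f x := by
  rw [intervalIntegral.integral_of_le zero_le_one, integral_Ioc_eq_integral_Ioo]

theorem integral_cos_int_mul_pi (k : ℤ) :
    ∫ x, Real.cos (k * Real.pi * x) ∂unitMeasure = if k = 0 then 1 else 0 := by
  rw [integral_unitMeasure]
  split_ifs with h
  · simp [h]
  · have hk : (k * Real.pi : ℝ) ≠ 0 := by positivity
    rw [intervalIntegral.integral_comp_mul_left _ hk]
    simp [Real.sin_int_mul_pi]

theorem continuous_dirichletEigenfunction (n : ℕ) : Continuous (dirichletEigenfunction n) := by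
  unfold dirichletEigenfunction; fun_prop

theorem dirichletEigenfunction_mul (m n : ℕ) (x : ℝ) :
    dirichletEigenfunction m x * dirichletEigenfunction n x =
      Real.cos (((m - n : ℤ) : ℝ) * Real.pi * x) - Real.cos (((m + n : ℤ) : ℝ) * Real.pi * x) := by
  unfold dirichletEigenfunction
  have h := Real.mul_self_sqrt (show (0 : ℝ) ≤ 2 by norm_num)
  push_cast
  rw [sub_mul, sub_mul, add_mul, add_mul, Real.cos_sub, Real.cos_add]
  linear_combination Real.sin (m * Real.pi * x) * Real.sin (n * Real.pi * x) * h

theorem integral_dirichletEigenfunction_mul (m n : ℕ) :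
    ∫ x, dirichletEigenfunction (m + 1) x * dirichletEigenfunction (n + 1) x ∂unitMeasure =
      if m = n then 1 else 0 := by
  have hi : ∀ k : ℤ, Integrable (fun x : ℝ => Real.cos (k * Real.pi * x)) unitMeasure := fun k =>
    ((by fun_prop : Continuous fun x : ℝ => Real.cos (k * Real.pi * x)).integrableOn_Icc
      (a := 0) (b := 1)).mono_set Ioo_subset_Icc_self
  simp only [dirichletEigenfunction_mul]
  rw [integral_sub (hi _) (hi _), integral_cos_int_mul_pi, integral_cos_int_mul_pi]
  have h1 : ¬ (((m + 1 : ℕ) : ℤ) + ((n + 1 : ℕ) : ℤ) = 0) := by omega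
  rw [if_neg h1, sub_zero]
  congr 1
  simp only [eq_iff_iff]
  omega

theorem memLp_dirichletEigenfunction (n : ℕ) :
    MemLp (fun x => (dirichletEigenfunction n x : ℂ)) 2 unitMeasure := by
  refine MemLp.of_bound (C := √2) (Complex.continuous_ofReal.comp
    (continuous_dirichletEigenfunction n)).aestronglyMeasurable (Eventually.of_forall fun x => ?_)
  rw [Complex.norm_real, Real.norm_eq_abs, dirichletEigenfunction, abs_mul,
    abs_of_nonneg (Real.sqrt_nonneg 2)]
  exact mul_le_of_le_one_right (Real.sqrt_nonneg 2) (Real.abs_sin_le_one _)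

/-- The functions `φ_{n+1}` as elements of `L²(0,1)`. -/
def sineL2 (n : ℕ) : L2 := (memLp_dirichletEigenfunction (n + 1)).toLp

theorem coeFn_sineL2 (n : ℕ) :
    sineL2 n =ᵐ[unitMeasure] fun x => (dirichletEigenfunction (n + 1) x : ℂ) :=
  MemLp.coeFn_toLp _

theorem inner_sineL2 (n : ℕ) (u : L2) :
    inner ℂ (sineL2 n) u = ∫ x, (dirichletEigenfunction (n + 1) x : ℂ) * u x ∂unitMeasure := by
  rw [L2.inner_def]
  refine integral_congr_ae ?_
  filter_upwards [coeFn_sineL2 n] with x hx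
  simp [hx, mul_comm]

theorem orthonormal_sineL2 : Orthonormal ℂ sineL2 := by
  rw [orthonormal_iff_ite]
  intro m n
  rw [inner_sineL2]
  have : ∫ x, (dirichletEigenfunction (m + 1) x : ℂ) * sineL2 n x ∂unitMeasure =
      ((∫ x, dirichletEigenfunction (m + 1) x * dirichletEigenfunction (n + 1) x ∂unitMeasure : ℝ) :
        ℂ) := by
    rw [← integral_complex_ofReal]
    refine integral_congr_ae ?_
    filter_upwards [coeFn_sineL2 n] with x hx
    simp [hx]
  rw [this, integral_dirichletEigenfunction_mul]
  split_ifs <;> simp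

/-- An integrable function on `(0,1)` that is orthogonal to all polynomials in `cos πx` vanishes. -/
theorem ae_eq_zero_of_integral_polynomial_cos {h : ℝ → ℂ} (hh : Integrable h unitMeasure)
    (H : ∀ p : Polynomial ℝ, ∫ x, p.eval (Real.cos (Real.pi * x)) • h x ∂unitMeasure = 0) :
    h =ᵐ[unitMeasure] 0 := by
  refine ae_eq_zero_of_integral_contDiff_smul_eq_zero hh.locallyIntegrable fun g hg _ => ?_
  have hgc : Continuous g := hg.continuous
  have hbd : ∀ {f : ℝ → ℝ}, Continuous f → Integrable (fun x => f x • h x) unitMeasure := by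
    intro f hf
    obtain ⟨C, hC⟩ := isCompact_Icc.exists_bound_of_continuousOn (s := Icc (0 : ℝ) 1) hf.continuousOn
    refine hh.bdd_smul C hf.aestronglyMeasurable ?_
    filter_upwards [ae_restrict_mem measurableSet_Ioo] with x hx
    exact hC x ⟨hx.1.le, hx.2.le⟩
  have hle : ∀ ε > 0, ‖∫ x, g x • h x ∂unitMeasure‖ ≤ ε * ∫ x, ‖h x‖ ∂unitMeasure := by
    intro ε hε
    -- The substitution `t = cos πx` maps `[0,1]` homeomorphically onto `[-1,1]`, so Weierstrass
    -- approximates every continuous `g` by polynomials in `cos πx`.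
    obtain ⟨p, hp⟩ := exists_polynomial_near_of_continuousOn (-1) 1
      (fun t => g (Real.arccos t / Real.pi))
      (hgc.comp (Real.continuous_arccos.div_const _)).continuousOn ε hε
    have hpc : Continuous fun x : ℝ => p.eval (Real.cos (Real.pi * x)) :=
      p.continuous.comp (by fun_prop)
    rw [← sub_zero (∫ x, g x • h x ∂unitMeasure), ← H p, ← integral_sub (hbd hgc) (hbd hpc),
      ← integral_const_mul]
    refine norm_integral_le_of_norm_le (hh.norm.const_mul ε) ?_
    filter_upwards [ae_restrict_mem measurableSet_Ioo] with x hx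
    rw [← sub_smul, norm_smul]
    refine mul_le_mul_of_nonneg_right ?_ (norm_nonneg _)
    have h1 := hp (Real.cos (Real.pi * x)) ⟨Real.neg_one_le_cos _, Real.cos_le_one _⟩
    rw [Real.arccos_cos (by nlinarith [hx.1, Real.pi_pos]) (by nlinarith [hx.2, Real.pi_pos]),
      mul_div_cancel_left₀ _ Real.pi_ne_zero] at h1
    rw [Real.norm_eq_abs, abs_sub_comm]
    exact h1.le
  by_contra hne
  have hpos := norm_pos_iff.2 hne
  have hI : 0 ≤ ∫ x, ‖h x‖ ∂unitMeasure := integral_nonneg fun _ => norm_nonneg _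
  have := hle (‖∫ x, g x • h x ∂unitMeasure‖ / (2 * (1 + ∫ x, ‖h x‖ ∂unitMeasure))) (by positivity)
  rw [div_mul_eq_mul_div, le_div_iff₀ (by positivity)] at this
  nlinarith

open Polynomial in
-- The span of the `U_n` contains `1` and is stable under multiplication by `X`, by `2 X U_n =
-- U_{n+1} + U_{n-1}` with `U_{-1} = 0`. Hence it is all of `ℝ[X]`.
theorem chebyshevU_induction {p : ℝ[X] → Prop} (hU : ∀ n : ℕ, p (Chebyshev.U ℝ n))
    (hadd : ∀ a b, p a → p b → p (a + b)) (hsmul : ∀ (c : ℝ) a, p a → p (c • a)) (q : ℝ[X]) : p q := by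
  have h0 : p 0 := by simpa using hsmul 0 _ (hU 0)
  let S : Submodule ℝ ℝ[X] :=
    { carrier := {q | p q}
      add_mem' := fun ha hb => hadd _ _ ha hb
      zero_mem' := h0
      smul_mem' := hsmul }
  let V := Submodule.span ℝ (range fun n : ℕ => Chebyshev.U ℝ (n : ℤ))
  have hV : V ≤ S := Submodule.span_le.2 (by rintro _ ⟨n, rfl⟩; exact hU n)
  have hX : ∀ a ∈ V, X * a ∈ V := by
    intro a ha
    induction ha using Submodule.span_induction with
    | mem a ha =>
      obtain ⟨n, rfl⟩ := ha
      have h2 : X * Chebyshev.U ℝ (n : ℤ) =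
          (1 / 2 : ℝ) • (Chebyshev.U ℝ ((n + 1 : ℕ) : ℤ) + Chebyshev.U ℝ ((n : ℤ) - 1)) := by
        have h3 := Chebyshev.U_add_one ℝ (n : ℤ)
        push_cast
        rw [h3, smul_eq_C_mul]
        have h4 : (C (1 / 2 : ℝ)) * 2 = (1 : ℝ[X]) := by
          rw [← C_ofNat, ← C_mul]; norm_num
        linear_combination (-X * Chebyshev.U ℝ (n : ℤ)) * h4
      rw [h2]
      refine V.smul_mem _ (V.add_mem (Submodule.subset_span ⟨n + 1, rfl⟩) ?_)
      cases n with
      | zero => simp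
      | succ n => exact Submodule.subset_span ⟨n, by push_cast; simp⟩
    | zero => simp
    | add a b _ _ ha hb => rw [mul_add]; exact V.add_mem ha hb
    | smul c a _ ha => rw [mul_smul_comm]; exact V.smul_mem c ha
  refine hV ?_
  have hmono : ∀ n, (X : ℝ[X]) ^ n ∈ V := fun n => by
    induction n with
    | zero => exact Submodule.subset_span ⟨0, by simp⟩
    | succ n ih => rw [pow_succ']; exact hX _ ih
  rw [q.as_sum_range_C_mul_X_pow]
  refine Submodule.sum_mem _ fun i _ => ?_
  rw [← smul_eq_C_mul]
  exact V.smul_mem _ (hmono i)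

/-- Completeness rests on `sin((n+1)πx) = U_n(cos πx) sin πx`: orthogonality to all sines makes `u ·
sin πx` orthogonal to all polynomials in `cos πx`, and `sin πx` has no zero in `(0,1)`. -/
theorem eq_zero_of_inner_sineL2 (u : L2) (hu : ∀ n, inner ℂ (sineL2 n) u = 0) : u = 0 := by
  have hi : Integrable (fun x => Real.sin (Real.pi * x) • u x) unitMeasure := by
    refine (integrable_L2 u).bdd_smul 1 (by fun_prop : Continuous fun x : ℝ =>
      Real.sin (Real.pi * x)).aestronglyMeasurable
      (Eventually.of_forall fun x => ?_)
    exact Real.abs_sin_le_one _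
  have hpi : ∀ p : Polynomial ℝ, Integrable (fun x =>
      p.eval (Real.cos (Real.pi * x)) • Real.sin (Real.pi * x) • u x) unitMeasure := fun p => by
    have hf : Continuous fun x : ℝ => p.eval (Real.cos (Real.pi * x)) :=
      p.continuous.comp (by fun_prop)
    obtain ⟨C, hC⟩ := isCompact_Icc.exists_bound_of_continuousOn (s := Icc (0 : ℝ) 1) hf.continuousOn
    refine hi.bdd_smul C hf.aestronglyMeasurable ?_
    filter_upwards [ae_restrict_mem measurableSet_Ioo] with x hx
    exact hC x ⟨hx.1.le, hx.2.le⟩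
  have h0 := ae_eq_zero_of_integral_polynomial_cos hi fun p => by
    induction p using chebyshevU_induction with
    | hU n =>
      have h1 := hu n
      rw [inner_sineL2] at h1
      have h2 : ∀ x, (dirichletEigenfunction (n + 1) x : ℂ) * u x =
          (√2 : ℂ) * ((Polynomial.Chebyshev.U ℝ n).eval (Real.cos (Real.pi * x)) •
            Real.sin (Real.pi * x) • u x) := fun x => by
        rw [smul_smul, Polynomial.Chebyshev.U_real_cos, dirichletEigenfunction]
        simp only [Complex.real_smul]
        push_cast
        ring_nf
      simp only [h2] at h1
      rw [integral_const_mul] at h1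
      exact (mul_eq_zero.1 h1).resolve_left (by simp)
    | hadd a b ha hb =>
      simp only [Polynomial.eval_add, add_smul]
      rw [integral_add (hpi a) (hpi b), ha, hb, add_zero]
    | hsmul c a ha =>
      simp only [Polynomial.eval_smul, smul_assoc]
      rw [integral_smul, ha, smul_zero]
  refine Lp.ext ?_
  filter_upwards [h0, Lp.coeFn_zero ℂ 2 unitMeasure, ae_restrict_mem measurableSet_Ioo]
    with x h1 h2 h3
  rw [h2]
  have h4 : Real.sin (Real.pi * x) ≠ 0 :=
    (Real.sin_pos_of_pos_of_lt_pi (by nlinarith [h3.1, Real.pi_pos])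
      (by nlinarith [h3.2, Real.pi_pos])).ne'
  exact (smul_eq_zero.1 h1).resolve_left h4

/-- The orthonormal basis `(φ_n)` of `L²(0,1)`. -/
def sineBasis : HilbertBasis ℕ ℂ L2 :=
  HilbertBasis.mkOfOrthogonalEqBot orthonormal_sineL2 (by
    rw [eq_bot_iff]
    intro u hu
    refine (Submodule.mem_bot ℂ).2 (eq_zero_of_inner_sineL2 u fun n => ?_)
    exact (Submodule.mem_orthogonal _ _).1 hu _ (Submodule.subset_span ⟨n, rfl⟩))

theorem coe_sineBasis : ⇑sineBasis = sineL2 :=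
  HilbertBasis.coe_mkOfOrthogonalEqBot _ _

theorem isDirichletSolution_dirichletEigenfunction (n : ℕ) :
    IsDirichletSolution (fun x => ((Real.pi ^ 2 * (n : ℝ) ^ 2 : ℝ) : ℂ) * dirichletEigenfunction n x)
      (fun x => (dirichletEigenfunction n x : ℂ)) := by
  have hlin : ∀ x : ℝ, HasDerivAt (fun x : ℝ => n * Real.pi * x) (n * Real.pi) x := fun x => by
    simpa using (hasDerivAt_id x).const_mul (n * Real.pi)
  have hd : ∀ x : ℝ, HasDerivAt (fun x => √2 * (Real.cos (n * Real.pi * x) * (n * Real.pi)))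
      (-(Real.pi ^ 2 * (n : ℝ) ^ 2 * dirichletEigenfunction n x)) x := fun x => by
    convert! ((hlin x).cos.mul_const (n * Real.pi)).const_mul √2 using 1
    unfold dirichletEigenfunction
    ring
  refine ⟨fun x => ((√2 * (Real.cos (n * Real.pi * x) * (n * Real.pi)) : ℝ) : ℂ), fun x _ => ?_,
    ?_, Eventually.of_forall fun x => ?_, by simp [dirichletEigenfunction], ?_⟩
  · exact ((hlin x).sin.const_mul √2).ofReal_comp.hasDerivWithinAt
  · refine ContDiffOn.absolutelyContinuousOnInterval (ContDiff.contDiffOn ?_)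
    exact Complex.ofRealCLM.contDiff.comp
      (by fun_prop : ContDiff ℝ 1 fun x : ℝ => √2 * (Real.cos (n * Real.pi * x) * (n * Real.pi)))
  · convert! (hd x).ofReal_comp using 1
    push_cast
    ring
  · have := Real.sin_nat_mul_pi n
    simp [dirichletEigenfunction, this]

/-- Uniqueness applied to `-φ'' = π²(n+1)² φ`. The eigenvalue is written as a square so that the one
of `R` can be read off. -/
theorem dirichletInverse_sineBasis (n : ℕ) :
    dirichletInverse (sineBasis n) =
      (((1 / (Real.pi * (n + 1))) ^ 2 : ℝ) : ℂ) • sineBasis n := by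
  rw [coe_sineBasis]
  have hi : Integrable (fun x => (dirichletEigenfunction (n + 1) x : ℂ)) unitMeasure :=
    (integrable_L2 (sineL2 n)).congr (coeFn_sineL2 n)
  have h := (isDirichletSolution_dirichletEigenfunction (n + 1)).eq_greenIntegral (hi.const_mul _)
  rw [greenIntegral_const_smul] at h
  refine Lp.ext ?_
  filter_upwards [coeFn_dirichletInverse (sineL2 n), Lp.coeFn_smul
    (((1 / (Real.pi * (n + 1))) ^ 2 : ℝ) : ℂ) (sineL2 n), coeFn_sineL2 n,
    ae_restrict_mem measurableSet_Ioo] with x h1 h2 h3 h4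
  rw [h1, h2, Pi.smul_apply, h3, h x ⟨h4.1.le, h4.2.le⟩, greenIntegral_congr_ae (coeFn_sineL2 n),
    smul_eq_mul, ← mul_assoc, ← Complex.ofReal_mul]
  have : (1 / (Real.pi * (n + 1))) ^ 2 * (Real.pi ^ 2 * ((n + 1 : ℕ) : ℝ) ^ 2) = 1 := by
    have := Real.pi_ne_zero
    have : (n : ℝ) + 1 ≠ 0 := by positivity
    push_cast
    field_simp
  rw [this, Complex.ofReal_one, one_mul]

end SineBasis

/-! ### The symmetrized operator `S = R M_ρ R` -/

section Symmetrization

theorem isPositive_dirichletInverse : dirichletInverse.IsPositive :=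
  isPositive_of_eigenbasis dirichletInverse_sineBasis fun _ => sq_nonneg _

/-- The positive square root of `A`. -/
def sqrtDirichletInverse : L2 →L[ℂ] L2 :=
  (exists_isPositive_mul_self_eq isPositive_dirichletInverse).choose

theorem isPositive_sqrtDirichletInverse : sqrtDirichletInverse.IsPositive :=
  (exists_isPositive_mul_self_eq isPositive_dirichletInverse).choose_spec.1

theorem sqrtDirichletInverse_mul_self :
    sqrtDirichletInverse * sqrtDirichletInverse = dirichletInverse :=
  (exists_isPositive_mul_self_eq isPositive_dirichletInverse).choose_spec.2

theorem adjoint_sqrtDirichletInverse : sqrtDirichletInverse.adjoint = sqrtDirichletInverse :=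
  isPositive_sqrtDirichletInverse.isSelfAdjoint.adjoint_eq

theorem sqrtDirichletInverse_sineBasis (n : ℕ) :
    sqrtDirichletInverse (sineBasis n) = ((1 / (Real.pi * (n + 1)) : ℝ) : ℂ) • sineBasis n :=
  apply_eigenvector_of_sq isPositive_sqrtDirichletInverse sqrtDirichletInverse_mul_self
    (by positivity) (dirichletInverse_sineBasis n)

theorem isHilbertSchmidt_sqrtDirichletInverse : IsHilbertSchmidt sqrtDirichletInverse := by
  refine ⟨ℕ, sineBasis, ?_⟩
  have h := ((summable_nat_add_iff 1).2
    (Real.summable_one_div_nat_pow.2 one_lt_two)).mul_left (1 / Real.pi ^ 2)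
  refine h.congr fun n => ?_
  rw [sqrtDirichletInverse_sineBasis, norm_smul, sineBasis.orthonormal.1, mul_one,
    Complex.norm_real, Real.norm_eq_abs, sq_abs]
  push_cast
  rw [← one_div_pow, ← one_div_pow, ← mul_pow, one_div_mul_one_div]

theorem sqrtDirichletInverse_injective : Function.Injective sqrtDirichletInverse := by
  rw [injective_iff_map_eq_zero]
  intro u hu
  refine eq_zero_of_inner_sineL2 u fun n => ?_
  have h := inner_eigenbasis_apply sqrtDirichletInverse_sineBasis n u
  rw [hu, inner_zero_right, coe_sineBasis] at h
  refine (mul_eq_zero.1 h.symm).resolve_left ?_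
  have : (1 / (Real.pi * (n + 1)) : ℝ) ≠ 0 := by positivity
  exact_mod_cast this

theorem inner_mulOperator (ρ : Density) (u v : L2) :
    inner ℂ u (mulOperator ρ v) =
      ∫ x, (ρ x : ℂ) * (starRingEnd ℂ (u x) * v x) ∂unitMeasure := by
  rw [L2.inner_def]
  refine integral_congr_ae ?_
  filter_upwards [coeFn_mulOperator ρ v] with x hx
  rw [hx, RCLike.inner_apply]
  ring

theorem isPositive_mulOperator {ρ : Density} (hρ : ∀ᵐ x ∂unitMeasure, 0 < ρ x) :
    (mulOperator ρ).IsPositive := by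
  rw [ContinuousLinearMap.isPositive_iff_complex]
  intro u
  have h : inner ℂ (mulOperator ρ u) u = ((∫ x, ρ x * ‖u x‖ ^ 2 ∂unitMeasure : ℝ) : ℂ) := by
    rw [← inner_conj_symm, inner_mulOperator, ← integral_conj, ← integral_complex_ofReal]
    refine integral_congr_ae (Eventually.of_forall fun x => ?_)
    simp only [map_mul, Complex.conj_ofReal, Complex.conj_conj, Complex.mul_conj,
      Complex.normSq_eq_norm_sq, Complex.ofReal_mul]
  rw [h]
  refine ⟨by simp, ?_⟩
  simp only [RCLike.re_to_complex, Complex.ofReal_re]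
  exact integral_nonneg_of_ae (hρ.mono fun x hx => mul_nonneg hx.le (sq_nonneg _))

theorem mulOperator_injective {ρ : Density} (hρ : ∀ᵐ x ∂unitMeasure, 0 < ρ x) :
    Function.Injective (mulOperator ρ) := by
  rw [injective_iff_map_eq_zero]
  intro u hu
  have h := coeFn_mulOperator ρ u
  rw [hu] at h
  refine Lp.ext ?_
  filter_upwards [h, hρ, Lp.coeFn_zero ℂ 2 unitMeasure] with x h1 h2 h3
  rw [h3, Pi.zero_apply] at h1 ⊢
  exact (mul_eq_zero.1 h1.symm).resolve_left (by exact_mod_cast h2.ne')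

/-- The symmetrized operator `A^{1/2} M_ρ A^{1/2}`. -/
def symmetrizedOperator (ρ : Density) : L2 →L[ℂ] L2 :=
  sqrtDirichletInverse * mulOperator ρ * sqrtDirichletInverse

theorem stringOperator_eq (ρ : Density) : stringOperator ρ =
    sqrtDirichletInverse * (sqrtDirichletInverse * mulOperator ρ) := by
  rw [← mul_assoc, sqrtDirichletInverse_mul_self]
  rfl

/-- This intertwining stands in for a similarity between `T` and `S`, which is unavailable because
`R`, being compact, has no bounded inverse. -/
theorem stringOperator_mul_sqrt (ρ : Density) : stringOperator ρ * sqrtDirichletInverse =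
    sqrtDirichletInverse * symmetrizedOperator ρ := by
  rw [stringOperator_eq, symmetrizedOperator]
  simp only [mul_assoc]

theorem isPositive_symmetrizedOperator {ρ : Density} (hρ : ∀ᵐ x ∂unitMeasure, 0 < ρ x) :
    (symmetrizedOperator ρ).IsPositive := by
  have h := (isPositive_mulOperator hρ).conj_adjoint sqrtDirichletInverse
  rwa [adjoint_sqrtDirichletInverse] at h

theorem symmetrizedOperator_injective {ρ : Density} (hρ : ∀ᵐ x ∂unitMeasure, 0 < ρ x) :
    Function.Injective (symmetrizedOperator ρ) :=
  sqrtDirichletInverse_injective.comp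
    ((mulOperator_injective hρ).comp sqrtDirichletInverse_injective)

theorem isCompactOperator_symmetrizedOperator (ρ : Density) :
    IsCompactOperator (symmetrizedOperator ρ) :=
  (isHilbertSchmidt_sqrtDirichletInverse.comp_left
    (sqrtDirichletInverse * mulOperator ρ)).isCompactOperator

theorem aeval_stringOperator_mul_sqrt (ρ : Density) (Q : Polynomial ℂ) :
    Polynomial.aeval (stringOperator ρ) Q * sqrtDirichletInverse =
      sqrtDirichletInverse * Polynomial.aeval (symmetrizedOperator ρ) Q := by
  have hpow : ∀ n : ℕ, stringOperator ρ ^ n * sqrtDirichletInverse =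
      sqrtDirichletInverse * symmetrizedOperator ρ ^ n := fun n =>
    (SemiconjBy.pow_right (a := sqrtDirichletInverse)
      (stringOperator_mul_sqrt ρ).symm n).eq.symm
  simp only [Polynomial.aeval_eq_sum_range, Finset.sum_mul, Finset.mul_sum, smul_mul_assoc,
    mul_smul_comm, hpow]

/-- `A^{1/2}` maps the eigenspaces of the symmetrized operator onto the solution spaces. -/
theorem rank_eigenspace_eq (ρ : Density) {μ : ℂ} (hμ : μ ≠ 0) :
    Module.rank ℂ (eigenspace ρ μ) =
      Module.rank ℂ (Module.End.eigenspace (symmetrizedOperator ρ : L2 →ₗ[ℂ] L2) μ⁻¹) := by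
  have hmul : ∀ u, stringOperator ρ (sqrtDirichletInverse u) =
      sqrtDirichletInverse (symmetrizedOperator ρ u) := fun u =>
    congrArg (fun S : L2 →L[ℂ] L2 => S u) (stringOperator_mul_sqrt ρ)
  have hmap : eigenspace ρ μ = (Module.End.eigenspace (symmetrizedOperator ρ : L2 →ₗ[ℂ] L2)
      μ⁻¹).map (sqrtDirichletInverse : L2 →ₗ[ℂ] L2) := by
    ext u
    rw [mem_eigenspace_iff ρ hμ, Submodule.mem_map]
    constructor
    · intro hu
      -- Since `R` is not onto, the preimage comes from the equation itself: `u = μ T u = R (μ R M_ρ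
      -- u)`. Injectivity of `R` then cancels it from `R S w = T u = R (μ⁻¹ w)`.
      set w : L2 := μ • sqrtDirichletInverse (mulOperator ρ u)
      have hw : sqrtDirichletInverse w = u := by
        have h1 : stringOperator ρ u =
          sqrtDirichletInverse (sqrtDirichletInverse (mulOperator ρ u)) := by
            rw [stringOperator_eq]; rfl
        rw [map_smul, ← h1, hu, smul_inv_smul₀ hμ]
      refine ⟨w, Module.End.mem_eigenspace_iff.2 (sqrtDirichletInverse_injective ?_), hw⟩
      change sqrtDirichletInverse (symmetrizedOperator ρ w) = _
      rw [← hmul, hw, hu, map_smul, hw]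
    · rintro ⟨w, hw, rfl⟩
      have hw' : symmetrizedOperator ρ w = μ⁻¹ • w := Module.End.mem_eigenspace_iff.1 hw
      change stringOperator ρ (sqrtDirichletInverse w) = μ⁻¹ • sqrtDirichletInverse w
      rw [hmul, hw', map_smul]
  rw [hmap]
  exact (Submodule.equivMapOfInjective _ sqrtDirichletInverse_injective _).rank_eq.symm

end Symmetrization

/-! ### Infinite matrices as matrices of `S` in the sine basis -/

section Matrices

/-- Moving one `R` to each side of the inner product produces the eigenvalues of `R` on the two
basis vectors, which supply the factor `1/(π² i j)`. -/
theorem densityMatrix_eq_inner (ρ : Density) (i j : ℕ) :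
    densityMatrix ρ i j = inner ℂ (sineBasis i) (symmetrizedOperator ρ (sineBasis j)) := by
  have h : inner ℂ (sineBasis i) (mulOperator ρ (sineBasis j)) =
      ((∫ x, dirichletEigenfunction (i + 1) x * dirichletEigenfunction (j + 1) x * ρ x ∂unitMeasure :
        ℝ) : ℂ) := by
    rw [inner_mulOperator, ← integral_complex_ofReal, coe_sineBasis]
    refine integral_congr_ae ?_
    filter_upwards [coeFn_sineL2 i, coeFn_sineL2 j] with x h1 h2
    rw [h1, h2, Complex.conj_ofReal]
    push_cast
    ring
  have h2 : inner ℂ (sineBasis i) (symmetrizedOperator ρ (sineBasis j)) =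
      inner ℂ (sqrtDirichletInverse (sineBasis i))
        (mulOperator ρ (sqrtDirichletInverse (sineBasis j))) :=
    (isPositive_sqrtDirichletInverse.inner_left_eq_inner_right _ _).symm
  rw [h2, sqrtDirichletInverse_sineBasis, sqrtDirichletInverse_sineBasis, map_smul,
    inner_smul_left, inner_smul_right, h, densityMatrix, Complex.conj_ofReal,
    ← Complex.ofReal_mul, ← Complex.ofReal_mul, ← mul_assoc]
  congr 2
  have := Real.pi_ne_zero
  have : (i : ℝ) + 1 ≠ 0 := by positivity
  have : (j : ℝ) + 1 ≠ 0 := by positivity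
  field_simp

/-- Parseval for `S* e_i` and the symmetrized operator applied to `e_j`: the formal matrix product
converges and represents the operator product. -/
theorem hasSum_inner_mul_densityMatrix (ρ : Density) (S : L2 →L[ℂ] L2) (i j : ℕ) :
    HasSum (fun k => inner ℂ (sineBasis i) (S (sineBasis k)) * densityMatrix ρ k j)
      (inner ℂ (sineBasis i) ((S * symmetrizedOperator ρ) (sineBasis j))) := by
  have h := sineBasis.hasSum_inner_mul_inner (S.adjoint (sineBasis i))
    (symmetrizedOperator ρ (sineBasis j))
  simp only [ContinuousLinearMap.adjoint_inner_left, ← densityMatrix_eq_inner] at h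
  exact h

theorem infPow_densityMatrix (ρ : Density) (s i j : ℕ) :
    infPow (densityMatrix ρ) s i j =
      inner ℂ (sineBasis i) ((symmetrizedOperator ρ ^ s) (sineBasis j)) := by
  induction s generalizing i j with
  | zero =>
    rw [pow_zero, one_apply_eq_self, orthonormal_iff_ite.1 sineBasis.orthonormal]
    rfl
  | succ s ih =>
    rw [pow_succ, ← (hasSum_inner_mul_densityMatrix ρ _ i j).tsum_eq]
    simp only [infPow, infMul, ih]

theorem infAeval_densityMatrix (ρ : Density) (P : Polynomial ℂ) (i j : ℕ) :
    infAeval P (densityMatrix ρ) i j =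
      inner ℂ (sineBasis i) (Polynomial.aeval (symmetrizedOperator ρ) P (sineBasis j)) := by
  rw [Polynomial.aeval_eq_sum_range, sum_apply, inner_sum, infAeval,
    Polynomial.sum_over_range _ (fun _ => zero_mul _)]
  simp only [infPow_densityMatrix, smul_apply, inner_smul_right]

/-- The factor `2` in the coefficient matrix is the product of the two normalizations `√2`; the rest
is linearity of the integral in the density. -/
theorem coeffMatrix_eq_densityMatrix {n : ℕ} (ψ : Fin n → Density) (a : Fin n → ℝ) :
    coeffMatrix ψ a = densityMatrix (∑ m, a m • ψ m) := by
  ext i j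
  rw [coeffMatrix, densityMatrix, Complex.ofReal_inj]
  have hcoe : (∑ m, a m • ψ m : Density) =ᵐ[unitMeasure] fun x => ∑ m, a m * ψ m x := by
    have h1 : ∀ m, ∀ᵐ x ∂unitMeasure, (a m • ψ m : Density) x = a m * ψ m x := fun m =>
      (Lp.coeFn_smul (a m) (ψ m)).mono fun x hx => by simpa using hx
    filter_upwards [Lp.coeFn_finsetSum Finset.univ (fun m => a m • ψ m), ae_all_iff.2 h1]
      with x hx hx'
    rw [hx, Finset.sum_apply]
    exact Finset.sum_congr rfl fun m _ => hx' m
  let S : ℝ → ℝ := fun x => Real.sin (((i : ℝ) + 1) * Real.pi * x) *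
    Real.sin (((j : ℝ) + 1) * Real.pi * x)
  have hi : ∀ m, Integrable (fun x => S x * ψ m x) unitMeasure := fun m => by
    refine ((Lp.memLp (ψ m)).integrable (by simp)).bdd_mul (c := 1)
      (by fun_prop : Continuous S).aestronglyMeasurable (Eventually.of_forall fun x => ?_)
    rw [Real.norm_eq_abs, abs_mul]
    exact mul_le_one₀ (Real.abs_sin_le_one _) (abs_nonneg _) (Real.abs_sin_le_one _)
  have h2 : ∫ x, dirichletEigenfunction (i + 1) x * dirichletEigenfunction (j + 1) x *
      (∑ m, a m • ψ m : Density) x ∂unitMeasure =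
      ∑ m, 2 * a m * ∫ x, S x * ψ m x ∂unitMeasure := by
    simp only [← integral_const_mul]
    rw [← integral_finsetSum _ fun m _ => (hi m).const_mul _]
    refine integral_congr_ae ?_
    filter_upwards [hcoe] with x hx
    rw [hx, Finset.mul_sum]
    refine Finset.sum_congr rfl fun m _ => ?_
    simp only [dirichletEigenfunction, S]
    have h := Real.mul_self_sqrt (show (0 : ℝ) ≤ 2 by norm_num)
    push_cast
    linear_combination (Real.sin (((i : ℝ) + 1) * Real.pi * x) *
      Real.sin (((j : ℝ) + 1) * Real.pi * x) * a m * ψ m x) * h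
  rw [h2, Finset.mul_sum]
  refine Finset.sum_congr rfl fun m _ => ?_
  simp only [S]
  ring

end Matrices

/-! ### Eigenvalues and the trace of `P(T)` -/

section Eigenvalues

theorem aeval_apply_of_apply_eq_smul {B : L2 →L[ℂ] L2} {x : L2} {c : ℂ} (h : B x = c • x)
    (P : Polynomial ℂ) : Polynomial.aeval B P x = P.eval c • x := by
  have hpow : ∀ n : ℕ, (B ^ n) x = c ^ n • x := fun n => by
    induction n with
    | zero => simp
    | succ n ih => rw [pow_succ, mul_apply_eq_comp, h, map_smul, ih, smul_smul, pow_succ']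
  rw [Polynomial.aeval_eq_sum_range, sum_apply, Polynomial.eval_eq_sum_range, Finset.sum_smul]
  simp only [smul_apply, hpow, smul_smul]

theorem infinite_of_hilbertBasis {ι : Type} (e : HilbertBasis ι ℂ L2) : Infinite ι := by
  by_contra hfin
  rw [not_infinite_iff_finite] at hfin
  have := Fintype.ofFinite ι
  have : Module.Finite ℂ L2 := Module.Finite.of_basis e.toOrthonormalBasis.toBasis
  have := sineBasis.orthonormal.linearIndependent.finite
  exact not_finite ℕ

open ComplexOrder in
-- Positivity of `S` makes the eigenvalues real and nonnegative; injectivity, where `ρ ≠ 0` almost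
-- everywhere enters, excludes `0`.
theorem exists_eigenbasis_symmetrizedOperator {ρ : Density} (hρ : ∀ᵐ x ∂unitMeasure, 0 < ρ x) :
    ∃ (ι : Type) (e : HilbertBasis ι ℂ L2) (κ : ι → ℝ), (∀ i, 0 < κ i) ∧
      ∀ i, symmetrizedOperator ρ (e i) = (κ i : ℂ) • e i := by
  have hpos := isPositive_symmetrizedOperator hρ
  obtain ⟨ι, e, κ, he⟩ :=
    exists_eigenbasis (isCompactOperator_symmetrizedOperator ρ) hpos.isSelfAdjoint
  have hinner : ∀ i, inner ℂ (e i) (symmetrizedOperator ρ (e i)) = κ i := fun i => by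
    rw [he, inner_smul_right, inner_self_eq_norm_sq_to_K, e.orthonormal.1]
    simp
  have hnn : ∀ i, 0 ≤ κ i := fun i => hinner i ▸ hpos.inner_nonneg_right (e i)
  have hne : ∀ i, κ i ≠ 0 := fun i h => by
    have h1 := he i
    rw [h, zero_smul, ← map_zero (symmetrizedOperator ρ)] at h1
    exact e.orthonormal.ne_zero i (symmetrizedOperator_injective hρ h1)
  have hre : ∀ i, ((κ i).re : ℂ) = κ i := fun i =>
    Complex.ext rfl (Complex.nonneg_iff.1 (hnn i)).2
  refine ⟨ι, e, fun i => (κ i).re, fun i => ?_, fun i => by rw [hre, he]⟩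
  refine lt_of_le_of_ne (Complex.nonneg_iff.1 (hnn i)).1 fun h => hne i ?_
  change 0 = (κ i).re at h
  rw [← hre, ← h, Complex.ofReal_zero]

/-- `S` is a product of two Hilbert–Schmidt operators, so its trace `∑ κ i` converges and `κ` tends
to zero. This gives finite multiplicities and lets the `1 / κ i` be sorted. -/
theorem finite_setOf_le_of_eigenbasis {ρ : Density} {ι : Type} {e : HilbertBasis ι ℂ L2} {κ : ι → ℝ}
    (he : ∀ i, symmetrizedOperator ρ (e i) = (κ i : ℂ) • e i) {c : ℝ} (hc : 0 < c) :
    {i | c ≤ κ i}.Finite := by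
  have hR := isHilbertSchmidt_sqrtDirichletInverse
  have h := (hR.hasSum_inner_comp (hR.comp_left (mulOperator ρ)) e e).summable
  have h2 : Summable κ := by
    refine Complex.summable_ofReal.1 (h.congr fun i => ?_)
    change inner ℂ (e i) (symmetrizedOperator ρ (e i)) = _
    rw [he, inner_smul_right, inner_self_eq_norm_sq_to_K, e.orthonormal.1]
    simp
  have h3 := h2.tendsto_cofinite_zero.eventually (gt_mem_nhds hc)
  refine (Filter.eventually_cofinite.1 h3).subset fun i hi => ?_
  simpa using hi

theorem encard_inv_fiber_eq {ρ : Density} {ι : Type} {e : HilbertBasis ι ℂ L2} {κ : ι → ℝ}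
    (hκ : ∀ i, 0 < κ i) (he : ∀ i, symmetrizedOperator ρ (e i) = (κ i : ℂ) • e i) (μ : ℂ) :
    {i | (((κ i)⁻¹ : ℝ) : ℂ) = μ}.Finite ∧ {i | (((κ i)⁻¹ : ℝ) : ℂ) = μ}.encard =
      Cardinal.toENat (Module.rank ℂ (eigenspace ρ μ)) := by
  by_cases hμ : μ = 0
  · have : {i | (((κ i)⁻¹ : ℝ) : ℂ) = μ} = ∅ := by
      ext i
      simpa [hμ] using (hκ i).ne'
    rw [this, hμ, eigenspace_zero]
    simp
  · have hset : {i | (((κ i)⁻¹ : ℝ) : ℂ) = μ} = {i | (κ i : ℂ) = μ⁻¹} := by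
      ext i
      simp only [mem_ofPred_eq, Complex.ofReal_inv]
      exact inv_eq_iff_eq_inv
    have hfin : {i | (κ i : ℂ) = μ⁻¹}.Finite := by
      rcases Set.eq_empty_or_nonempty {i | (κ i : ℂ) = μ⁻¹} with h | ⟨i₀, hi₀⟩
      · rw [h]; exact Set.finite_empty
      · refine (finite_setOf_le_of_eigenbasis he (hκ i₀)).subset fun i hi => ?_
        exact (Complex.ofReal_inj.1 (hi₀.trans hi.symm)).le
    rw [hset]
    exact ⟨hfin, by rw [rank_eigenspace_eq ρ hμ, toENat_rank_eigenspace he _ hfin]⟩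

theorem exists_trace_aeval_stringOperator (ρ : Density) (P : Polynomial ℂ) (hP : P.eval 0 = 0) :
    ∃ t : ℂ, HasTrace (Polynomial.aeval (stringOperator ρ) P) t ∧
      ∀ (ι : Type) (f : HilbertBasis ι ℂ L2),
        HasSum (fun i => inner ℂ (f i) (Polynomial.aeval (symmetrizedOperator ρ) P (f i))) t := by
  obtain ⟨Q, rfl⟩ := Polynomial.dvd_iff_isRoot.2 hP
  rw [Polynomial.C_0, sub_zero]
  have hR := isHilbertSchmidt_sqrtDirichletInverse
  have hD := (hR.comp_right
    (mulOperator ρ * Polynomial.aeval (stringOperator ρ) Q))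
  -- Here `C = R` and `D = R M_ρ Q(T)`, so that `CD = T Q(T) = P(T)` and `DC = R M_ρ Q(T) R = S Q(S)
  -- = P(S)`.
  obtain ⟨t, h1, h2⟩ := hR.exists_hasTrace_comp hD
  refine ⟨t, ?_, fun ι f => ?_⟩
  · have : Polynomial.aeval (stringOperator ρ) (Polynomial.X * Q) = sqrtDirichletInverse ∘L
        (sqrtDirichletInverse ∘L (mulOperator ρ * Polynomial.aeval (stringOperator ρ) Q)) := by
      rw [map_mul, Polynomial.aeval_X, stringOperator_eq, mul_assoc, mul_assoc]
      rfl
    rwa [this]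
  · have : Polynomial.aeval (symmetrizedOperator ρ) (Polynomial.X * Q) =
        sqrtDirichletInverse * mulOperator ρ *
          (Polynomial.aeval (stringOperator ρ) Q * sqrtDirichletInverse) := by
      rw [aeval_stringOperator_mul_sqrt, map_mul, Polynomial.aeval_X, ← mul_assoc]
      rfl
    simp only [this]
    exact h2 ι f

end Eigenvalues

end StringDensity

end

/-! ### The trace formula -/

theorem mainTheorem3 (ρ : StringDensity.Density)
    (hρ : ∀ᵐ x ∂StringDensity.unitMeasure, 0 < ρ x)
    (P : Polynomial ℂ) (hP : P.eval 0 = 0) :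
    (∃ lam : ℕ → ℝ, Monotone lam ∧ (∀ k, 0 < lam k) ∧
      StringDensity.IsEigenvalueEnumeration ρ (fun k => (lam k : ℂ))) ∧
    (∀ s i j, Summable fun k =>
      StringDensity.infPow (StringDensity.densityMatrix ρ) s i k *
        StringDensity.densityMatrix ρ k j) ∧
    ∃ t : ℂ,
      (∀ lam : ℕ → ℂ, StringDensity.IsEigenvalueEnumeration ρ lam →
        HasSum (fun k => P.eval (lam k)⁻¹) t) ∧
      StringDensity.HasTrace (Polynomial.aeval (StringDensity.stringOperator ρ) P) t ∧
      HasSum (fun i => StringDensity.infAeval P (StringDensity.densityMatrix ρ) i i) t ∧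
      (∀ (n : ℕ) (ψ : Fin n → StringDensity.Density) (a : Fin n → ℝ), ρ = ∑ m, a m • ψ m →
        HasSum (fun i => StringDensity.infAeval P (StringDensity.coeffMatrix ψ a) i i) t) := by
  obtain ⟨ι, e, κ, hκ, he⟩ := StringDensity.exists_eigenbasis_symmetrizedOperator hρ
  have hfib := StringDensity.encard_inv_fiber_eq hκ he
  have := StringDensity.infinite_of_hilbertBasis e
  obtain ⟨t, ht, hsum⟩ := StringDensity.exists_trace_aeval_stringOperator ρ P hP
  have hmat : HasSum (fun i => StringDensity.infAeval P (StringDensity.densityMatrix ρ) i i) t := by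
    simpa only [StringDensity.infAeval_densityMatrix] using hsum ℕ StringDensity.sineBasis
  have heig : HasSum (fun i => P.eval (κ i : ℂ)) t := by
    convert! hsum ι e using 2 with i
    rw [StringDensity.aeval_apply_of_apply_eq_smul (he i), inner_smul_right,
      inner_self_eq_norm_sq_to_K, e.orthonormal.1]
    simp
  refine ⟨?_, fun s i j => ?_, t, fun lam hlam => ?_, ht, hmat, fun n ψ a hψ => ?_⟩
  · obtain ⟨σ, hσ⟩ := StringDensity.exists_equiv_monotone (fun i => (κ i)⁻¹) fun c => by
      rcases le_or_gt c 0 with hc | hc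
      · refine Set.finite_empty.subset fun i hi => ?_
        exact absurd (inv_pos.2 (hκ i)) (not_lt.2 (le_trans hi hc))
      · refine (StringDensity.finite_setOf_le_of_eigenbasis he (inv_pos.2 hc)).subset fun i hi => ?_
        exact (inv_le_comm₀ (hκ i) hc).1 hi
    refine ⟨_, hσ, fun k => inv_pos.2 (hκ _), fun μ => ?_⟩
    rw [← (hfib μ).2]
    exact Set.encard_preimage_of_bijective σ.bijective {i | (((κ i)⁻¹ : ℝ) : ℂ) = μ}
  · simp only [StringDensity.infPow_densityMatrix]
    exact (StringDensity.hasSum_inner_mul_densityMatrix ρ _ i j).summable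
  -- An arbitrary enumeration has the same fiber sizes as `i ↦ 1 / κ i`, so it is a reindexing of
  -- that family and inherits its sum.
  · obtain ⟨σ, hσ⟩ := StringDensity.exists_equiv_of_encard_fiber_eq lam
      (fun i => (((κ i)⁻¹ : ℝ) : ℂ)) (fun μ => (hfib μ).1) fun μ => (hlam μ).trans (hfib μ).2.symm
    convert! σ.hasSum_iff.2 heig using 2 with k
    rw [Function.comp_apply, ← hσ k, Complex.ofReal_inv, inv_inv]
  · rw [StringDensity.coeffMatrix_eq_densityMatrix, ← hψ]
    exact hmat
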